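/- Let $\beta>0$ and $n\ge 1$. Let $(\lambda_1,\dots,\lambda_n)\in(0,\infty)^n$ be distributed as the eigenvalues of the $\beta$-Wishart (Laguerre) ensemble with rectangularity parameter $c=1$ (square data matrices), that is, with joint probability density $$\mathcal P(\lambda_1,\dots,\lambda_n)=\frac1{\mathcal Z_n}e^{-\beta E[\lambda]},\qquad E[\lambda]=-\frac12\sum_{i\ne j}\ln|\lambda_i-\lambda_j|+n\sum_{k=1}^n\Big(\frac{\lambda_k}{2}-\alpha\ln\lambda_k\Big),\qquad \alpha=\frac1{2n}-\frac1{\beta n},$$ where $\mathcal Z_n=\int_{(0,\infty)^n}e^{-\beta E[\lambda]}\,d\lambda\in(0,\infty)$. Let $H=\frac1n\sum_{i=1}^n\ln\lambda_i$ be the scaled log-determinant and, for $x>0$, let $\psi_m(x)=\frac{d^{m+1}}{dx^{m+1}}\ln\Gamma(x)$ be the polygamma functions. Then $H$ is square-integrable and, for every $n\ge1$, $$\mathrm{var}(H)=\frac1{n^2}\sum_{j=0}^{n-1}\psi_1\Big(\frac{\beta}{2}(j+1)\Big).$$ Moreover, for every fixed $\beta>0$, as $n\to\infty$, $$\frac{\mathrm{var}(H)}{2/(\beta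 n^2)}=\ln n+\ln(\beta/2)-\psi_0(\beta/2)+1+K_\beta+o(1),$$ where $K_\beta$ is given by the absolutely convergent integral $$K_\beta=\frac{2}{\beta^2}\int_0^\infty \frac{t\,e^{-2t(1-1/\beta)}\big(\beta e^{2t/\beta}-2e^{t}+2-\beta\big)}{(1-e^{-t})\,(e^{2t/\beta}-1)^{2}}\,dt .$$ In particular, $K_1=\pi^2/8-\ln 2$, $K_2=0$ and $K_4=1-\pi^2/8$. -/

import Mathlib

open MeasureTheory ProbabilityTheory Filter Topology
open scoped ENNReal BigOperators

noncomputable section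

/-- The exponent `α = (c - 1)/2 + 1/(2n) - 1/(βn)` of the Laguerre (Wishart) weight. -/
def laguerreAlpha (n : ℕ) (β c : ℝ) : ℝ :=
  (c - 1) / 2 + 1 / (2 * (n : ℝ)) - 1 / (β * (n : ℝ))

/-- The external potential `V(x) = x/2 - α ln x` on `x > 0`
(the value `+∞` off the half-line is implemented by `finiteEnergyConfigs`). -/
def laguerrePotential (n : ℕ) (β c x : ℝ) : ℝ :=
  x / 2 - laguerreAlpha n β c * Real.log x

/-- The configurations of finite energy: positive, pairwise distinct eigenvalues. -/
def finiteEnergyConfigs (n : ℕ) : Set (Fin n → ℝ) :=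
  {x | (∀ i, 0 < x i) ∧ Function.Injective x}

/-- The energy `E[x] = -(1/2) ∑_{i ≠ j} ln |x_i - x_j| + n ∑_k V(x_k)` of a configuration in
`finiteEnergyConfigs n`. -/
def coulombEnergy (n : ℕ) (β c : ℝ) (x : Fin n → ℝ) : ℝ :=
  -(1 / 2) * ∑ p ∈ (Finset.univ : Finset (Fin n)).offDiag, Real.log |x p.1 - x p.2|
    + (n : ℝ) * ∑ k, laguerrePotential n β c (x k)

/-- The measure `e^{-β E[x]} dx`, which gives no mass to configurations of infinite energy. -/
def unnormalizedGibbs (n : ℕ) (β c : ℝ) : Measure (Fin n → ℝ) :=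
  (volume.restrict (finiteEnergyConfigs n)).withDensity
    (fun x => ENNReal.ofReal (Real.exp (-β * coulombEnergy n β c x)))

/-- The partition function `Z_n = ∫ e^{-β E[x]} dx`. -/
def partitionFunction (n : ℕ) (β c : ℝ) : ℝ≥0∞ :=
  unnormalizedGibbs n β c Set.univ

/-- The joint law `Z_n⁻¹ e^{-β E[x]} dx` of the eigenvalues of the `β`-Wishart ensemble with
rectangularity parameter `c`. -/
def wishartEigenvalueLaw (n : ℕ) (β c : ℝ) : Measure (Fin n → ℝ) :=
  (partitionFunction n β c)⁻¹ • unnormalizedGibbs n β c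

/-- The scaled log-determinant `H = (1/n) ∑_i ln x_i`. -/
def scaledLogDet (n : ℕ) (x : Fin n → ℝ) : ℝ :=
  (1 / (n : ℝ)) * ∑ i, Real.log (x i)

/-- The polygamma function `ψ_m(x) = ∂_x^{m+1} ln Γ(x)`, for `x > 0`. -/
def polygamma (m : ℕ) (x : ℝ) : ℝ :=
  iteratedDeriv (m + 1) (fun y => Real.log (Real.Gamma y)) x

/-- The integrand of `K_β`, without the prefactor `2/β²`. -/
def logDetConstIntegrand (β t : ℝ) : ℝ :=
  t * Real.exp (-2 * t * (1 - 1 / β))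
    * (β * Real.exp (2 * t / β) - 2 * Real.exp t + 2 - β)
    * (1 - Real.exp (-t))⁻¹ * ((Real.exp (2 * t / β) - 1) ^ 2)⁻¹

/-- The constant `K_β`. -/
def logDetConst (β : ℝ) : ℝ :=
  (2 / β ^ 2) * ∫ t in Set.Ioi (0 : ℝ), logDetConstIntegrand β t

end

namespace LaguerreEnsemble

/-! ### Aomoto's recursion for the Laguerre ensemble -/

/-- Lebesgue measure on the open positive orthant. -/
noncomputable def orthant (n : ℕ) : Measure (Fin n → ℝ) :=
  Measure.pi fun _ : Fin n => volume.restrict (Set.Ioi (0 : ℝ))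

instance (n : ℕ) : SigmaFinite (orthant n) := by unfold orthant; infer_instance

/-- The product Laguerre weight `∏ x_k^{a-1} e^{-r x_k}`. -/
noncomputable def weight {n : ℕ} (a r : ℝ) (x : Fin n → ℝ) : ℝ :=
  ∏ k, (x k ^ (a - 1) * Real.exp (-r * x k))

/-- The regularised Vandermonde factor `∏_{i ≠ j} ((x_i - x_j)² + ε)^b`. -/
noncomputable def vand {n : ℕ} (b ε : ℝ) (x : Fin n → ℝ) : ℝ :=
  ∏ p ∈ (Finset.univ : Finset (Fin n)).offDiag, ((x p.1 - x p.2) ^ 2 + ε) ^ b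

lemma ae_orthant_pos (n : ℕ) : ∀ᵐ x ∂(orthant n), ∀ i, 0 < x i := by
  rw [ae_all_iff]
  intro i
  have h : ∀ᵐ t ∂(volume.restrict (Set.Ioi (0 : ℝ))), 0 < t := ae_restrict_mem measurableSet_Ioi
  exact (Measure.tendsto_eval_ae_ae (μ := fun _ : Fin n => volume.restrict (Set.Ioi (0 : ℝ)))
    (i := i)).eventually h

lemma measurable_weight {n : ℕ} (a r : ℝ) : Measurable (weight (n := n) a r) := by
  unfold weight
  fun_prop

lemma measurable_vand {n : ℕ} (b ε : ℝ) : Measurable (vand (n := n) b ε) := by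
  unfold vand
  fun_prop

lemma weight_pos {n : ℕ} (a r : ℝ) {x : Fin n → ℝ} (hx : ∀ i, 0 < x i) : 0 < weight a r x :=
  Finset.prod_pos fun k _ => mul_pos (Real.rpow_pos_of_pos (hx k) _) (Real.exp_pos _)

lemma vand_nonneg {n : ℕ} (b : ℝ) {ε : ℝ} (hε : 0 ≤ ε) (x : Fin n → ℝ) : 0 ≤ vand b ε x :=
  Finset.prod_nonneg fun p _ => Real.rpow_nonneg (by positivity) _

lemma weight_add {n : ℕ} (a r t : ℝ) {x : Fin n → ℝ} (hx : ∀ i, 0 < x i) :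
    weight (a + t) r x = Real.exp (t * ∑ i, Real.log (x i)) * weight a r x := by
  rw [Finset.mul_sum, Real.exp_sum, weight, weight, ← Finset.prod_mul_distrib]
  refine Finset.prod_congr rfl fun k _ => ?_
  rw [show a + t - 1 = t + (a - 1) by ring, Real.rpow_add (hx k), Real.rpow_def_of_pos (hx k) t,
    mul_comm t, mul_assoc]

lemma weight_add_one {n : ℕ} (a r : ℝ) {x : Fin n → ℝ} (hx : ∀ i, 0 < x i) :
    weight (a + 1) r x = (∏ i, x i) * weight a r x := by
  rw [weight_add a r 1 hx, one_mul, Real.exp_sum]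
  congr 1
  exact Finset.prod_congr rfl fun k _ => Real.exp_log (hx k)

lemma weight_perm {n : ℕ} (a r : ℝ) (σ : Equiv.Perm (Fin n)) (x : Fin n → ℝ) :
    weight a r (x ∘ σ) = weight a r x :=
  Equiv.prod_comp σ fun k => x k ^ (a - 1) * Real.exp (-r * x k)

lemma vand_perm {n : ℕ} (b ε : ℝ) (σ : Equiv.Perm (Fin n)) (x : Fin n → ℝ) :
    vand b ε (x ∘ σ) = vand b ε x := by
  refine Finset.prod_equiv (Equiv.prodCongr σ σ) ?_ ?_
  · rintro ⟨i, j⟩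
    simp
  · rintro ⟨i, j⟩ _
    rfl

lemma integral_orthant_perm {n : ℕ} (σ : Equiv.Perm (Fin n)) (f : (Fin n → ℝ) → ℝ) :
    ∫ x, f (x ∘ σ) ∂(orthant n) = ∫ x, f x ∂(orthant n) := by
  have h := measurePreserving_piCongrLeft (α := fun _ : Fin n => ℝ)
    (fun _ : Fin n => volume.restrict (Set.Ioi (0 : ℝ))) σ
  rw [orthant, ← h.integral_comp']
  refine integral_congr_ae (Eventually.of_forall fun x => ?_)
  refine congrArg f (funext fun i => ?_)
  exact Equiv.piCongrLeft_apply_apply (fun _ : Fin n => ℝ) σ x i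

/-- The bound `∏ (1 + x_k)` controlling all polynomial factors. -/
noncomputable def growth {n : ℕ} (x : Fin n → ℝ) : ℝ := ∏ k, (1 + x k)

lemma one_le_prod_one_add {n : ℕ} {x : Fin n → ℝ} (hx : ∀ i, 0 < x i) (S : Finset (Fin n)) :
    1 ≤ ∏ k ∈ S, (1 + x k) := by
  refine Finset.prod_induction (fun k => 1 + x k) (fun y => 1 ≤ y) (fun a b ha hb => ?_) le_rfl
    fun k _ => by linarith [hx k]
  exact one_le_mul_of_one_le_of_one_le ha hb

lemma one_le_growth {n : ℕ} {x : Fin n → ℝ} (hx : ∀ i, 0 < x i) : 1 ≤ growth x :=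
  one_le_prod_one_add hx _

lemma prod_le_growth {n : ℕ} {x : Fin n → ℝ} (hx : ∀ i, 0 < x i) (S : Finset (Fin n)) :
    ∏ k ∈ S, (1 + x k) ≤ growth x := by
  rw [growth, ← Finset.prod_mul_prod_compl S]
  exact le_mul_of_one_le_right (zero_le_one.trans (one_le_prod_one_add hx _))
    (one_le_prod_one_add hx _)

lemma integrableOn_growth_one (M : ℕ) {a r : ℝ} (ha : 0 < a) (hr : 0 < r) :
    IntegrableOn (fun t : ℝ => (1 + t) ^ M * (t ^ (a - 1) * Real.exp (-r * t))) (Set.Ioi 0) := by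
  induction M generalizing a with
  | zero =>
    have := integrableOn_rpow_mul_exp_neg_mul_rpow (p := 1) (s := a - 1) (by linarith) one_pos hr
    simpa using this
  | succ M ih =>
    refine ((ih ha).add (ih (a := a + 1) (by linarith))).congr_fun ?_ measurableSet_Ioi
    intro t ht
    have : t ^ (a + 1 - 1) = t * t ^ (a - 1) := by
      rw [show a + 1 - 1 = 1 + (a - 1) by ring, Real.rpow_add ht, Real.rpow_one]
    simp only [Pi.add_apply, this]
    ring

lemma integrable_growth {n : ℕ} (M : ℕ) {a r : ℝ} (ha : 0 < a) (hr : 0 < r) :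
    Integrable (fun x : Fin n → ℝ => growth x ^ M * weight a r x) (orthant n) := by
  have := Integrable.fintype_prod (ι := Fin n) (μ := fun _ => volume.restrict (Set.Ioi (0 : ℝ)))
    (f := fun _ t => (1 + t) ^ M * (t ^ (a - 1) * Real.exp (-r * t)))
    fun _ => integrableOn_growth_one M ha hr
  refine this.congr (Eventually.of_forall fun x => ?_)
  simp only [growth, weight, ← Finset.prod_pow, ← Finset.prod_mul_distrib]

lemma integrable_of_growth {n : ℕ} {F : (Fin n → ℝ) → ℝ} (hF : Measurable F) (C : ℝ) (M : ℕ)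
    (h : ∀ x : Fin n → ℝ, (∀ i, 0 < x i) → |F x| ≤ C * growth x ^ M)
    {a r : ℝ} (ha : 0 < a) (hr : 0 < r) :
    Integrable (fun x => F x * weight a r x) (orthant n) := by
  refine ((integrable_growth M ha hr).const_mul C).mono'
    (hF.mul (measurable_weight a r)).aestronglyMeasurable ?_
  filter_upwards [ae_orthant_pos n] with x hx
  rw [norm_mul, Real.norm_eq_abs, Real.norm_of_nonneg (weight_pos a r hx).le, ← mul_assoc]
  exact mul_le_mul_of_nonneg_right (h x hx) (weight_pos a r hx).le

lemma exists_vand_le (n : ℕ) {b : ℝ} (hb : 0 ≤ b) : ∃ M : ℕ, ∀ ε : ℝ, 0 ≤ ε → ε ≤ 1 →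
    ∀ x : Fin n → ℝ, (∀ i, 0 < x i) → vand b ε x ≤ growth x ^ M := by
  refine ⟨2 * ⌈b⌉₊ * (Finset.univ : Finset (Fin n)).offDiag.card, fun ε h0 h1 x hx => ?_⟩
  rw [pow_mul, ← Finset.prod_const]
  refine Finset.prod_le_prod (fun p _ => Real.rpow_nonneg (by positivity) _) fun p hp => ?_
  have hne : p.1 ≠ p.2 := (Finset.mem_offDiag.1 hp).2.2
  have hB : (1 + x p.1) * (1 + x p.2) ≤ growth x := by
    have := prod_le_growth hx {p.1, p.2}
    rwa [Finset.prod_pair hne] at this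
  have h1B := one_le_growth hx
  have hle : (x p.1 - x p.2) ^ 2 + ε ≤ growth x ^ 2 := by
    have hp1 := hx p.1
    have hp2 := hx p.2
    have : ((1 + x p.1) * (1 + x p.2)) ^ 2 ≤ growth x ^ 2 := by gcongr
    nlinarith [mul_pos hp1 hp2, sq_nonneg (x p.1 * x p.2), mul_pos (mul_pos hp1 hp2) hp1,
      mul_pos (mul_pos hp1 hp2) hp2]
  calc ((x p.1 - x p.2) ^ 2 + ε) ^ b ≤ (growth x ^ 2) ^ b :=
        Real.rpow_le_rpow (by positivity) hle hb
    _ ≤ (growth x ^ 2) ^ (⌈b⌉₊ : ℝ) :=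
        Real.rpow_le_rpow_of_exponent_le (one_le_pow₀ h1B) (Nat.le_ceil b)
    _ = growth x ^ (2 * ⌈b⌉₊) := by rw [Real.rpow_natCast, pow_mul]

lemma abs_prod_le_growth {n : ℕ} {x : Fin n → ℝ} (hx : ∀ i, 0 < x i) (S : Finset (Fin n)) :
    |∏ k ∈ S, x k| ≤ growth x := by
  rw [abs_of_nonneg (Finset.prod_nonneg fun k _ => (hx k).le)]
  refine le_trans ?_ (prod_le_growth hx S)
  exact Finset.prod_le_prod (fun k _ => (hx k).le) fun k _ => by linarith

lemma coord_le_growth {n : ℕ} {x : Fin n → ℝ} (hx : ∀ i, 0 < x i) (i : Fin n) :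
    x i ≤ growth x := by
  have := abs_prod_le_growth hx {i}
  rw [Finset.prod_singleton] at this
  exact (le_abs_self _).trans this

/-- The integral of a partial derivative over the orthant vanishes. -/
lemma integral_partial_eq_zero {m : ℕ} (i : Fin (m + 1)) {G G' : (Fin (m + 1) → ℝ) → ℝ}
    (hG : Integrable G (orthant (m + 1))) (hG' : Integrable G' (orthant (m + 1)))
    (hzero : ∀ y : Fin m → ℝ, (∀ j, 0 < y j) → G (i.insertNth (0 : ℝ) y) = 0)
    (hcont : ∀ y : Fin m → ℝ, (∀ j, 0 < y j) →
      ContinuousWithinAt (fun t : ℝ => G (i.insertNth t y)) (Set.Ici 0) 0)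
    (hder : ∀ y : Fin m → ℝ, (∀ j, 0 < y j) → ∀ t : ℝ, 0 < t →
      HasDerivAt (fun t : ℝ => G (i.insertNth t y)) (G' (i.insertNth t y)) t) :
    ∫ x, G' x ∂(orthant (m + 1)) = 0 := by
  have hmp := (measurePreserving_piFinSuccAbove (α := fun _ : Fin (m + 1) => ℝ)
    (fun _ => volume.restrict (Set.Ioi (0 : ℝ))) i).symm
  have e1 : ∀ F : (Fin (m + 1) → ℝ) → ℝ, Integrable F (orthant (m + 1)) →
      Integrable (fun z : ℝ × (Fin m → ℝ) => F (i.insertNth z.1 z.2))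
        ((volume.restrict (Set.Ioi (0 : ℝ))).prod (orthant m)) := by
    intro F hF
    exact (hmp.integrable_comp_emb (MeasurableEquiv.measurableEmbedding _)).2 hF
  have e2 : ∫ x, G' x ∂(orthant (m + 1)) = ∫ z : ℝ × (Fin m → ℝ), G' (i.insertNth z.1 z.2)
      ∂((volume.restrict (Set.Ioi (0 : ℝ))).prod (orthant m)) :=
    (hmp.integral_comp' G').symm
  rw [e2, integral_prod_symm _ (e1 G' hG')]
  refine integral_eq_zero_of_ae ?_
  filter_upwards [ae_orthant_pos m, (e1 G hG).prod_left_ae, (e1 G' hG').prod_left_ae]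
    with y hy h1 h2
  have ht := tendsto_zero_of_hasDerivAt_of_integrableOn_Ioi (fun t ht => hder y hy t ht) h2 h1
  have := integral_Ioi_of_hasDerivAt_of_tendsto (hcont y hy) (fun t ht => hder y hy t ht) h2 ht
  simpa [hzero y hy] using this

lemma weight_insertNth {m : ℕ} (a r : ℝ) (i : Fin (m + 1)) (t : ℝ) (y : Fin m → ℝ) :
    weight a r (i.insertNth t y : Fin (m + 1) → ℝ)
      = t ^ (a - 1) * Real.exp (-r * t) * weight a r y := by
  simp [weight, Fin.prod_univ_succAbove _ i]

/-- Integration by parts against the Laguerre weight in a single coordinate. -/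
lemma integral_stein {n : ℕ} (i : Fin n) {a r : ℝ} (ha : 0 < a)
    {F F' : (Fin n → ℝ) → ℝ}
    (hF : Integrable (fun x => x i * F x * weight a r x) (orthant n))
    (hF' : Integrable (fun x => ((a - r * x i) * F x + x i * F' x) * weight a r x) (orthant n))
    (hder : ∀ x : Fin n → ℝ, HasDerivAt (fun t => F (Function.update x i t)) (F' x) (x i)) :
    ∫ x, ((a - r * x i) * F x + x i * F' x) * weight a r x ∂(orthant n) = 0 := by
  obtain _ | m := n
  · exact i.elim0
  have hd : ∀ (y : Fin m → ℝ) (t : ℝ),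
      HasDerivAt (fun t : ℝ => F (i.insertNth t y)) (F' (i.insertNth t y)) t := by
    intro y t
    have := hder (i.insertNth t y)
    simpa [Fin.update_insertNth] using this
  refine integral_partial_eq_zero i hF hF' (fun y _ => by simp) (fun y _ => ?_) fun y _ t ht => ?_
  · have h1 : ContinuousWithinAt (fun t : ℝ => t ^ a * Real.exp (-r * t) * F (i.insertNth t y)
        * weight a r y) (Set.Ici 0) 0 := by
      refine ContinuousAt.continuousWithinAt ?_
      refine ContinuousAt.mul (ContinuousAt.mul (ContinuousAt.mul ?_ ?_) ?_) continuousAt_const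
      · exact Real.continuousAt_rpow_const _ _ (Or.inr ha.le)
      · fun_prop
      · exact (hd y 0).continuousAt
    refine h1.congr (fun t ht => ?_) ?_
    · rw [weight_insertNth, Fin.insertNth_apply_same]
      rcases (Set.mem_Ici.1 ht).eq_or_lt with rfl | h
      · simp [Real.zero_rpow ha.ne']
      · rw [show a = 1 + (a - 1) by ring, Real.rpow_add h, Real.rpow_one]
        ring_nf
    · simp [Real.zero_rpow ha.ne']
  · simp only [weight_insertNth, Fin.insertNth_apply_same]
    have h1 : HasDerivAt (fun t : ℝ => t ^ (a - 1)) ((a - 1) * t ^ (a - 1 - 1)) t :=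
      Real.hasDerivAt_rpow_const (Or.inl ht.ne')
    have h2 : HasDerivAt (fun t : ℝ => Real.exp (-r * t)) (Real.exp (-r * t) * (-r * 1)) t :=
      ((hasDerivAt_id t).const_mul (-r)).exp
    have h := ((hasDerivAt_id t).mul (hd y t)).mul ((h1.mul h2).mul_const (weight a r y))
    refine h.congr_deriv ?_
    have h3 : t ^ (a - 1) = t * t ^ (a - 1 - 1) := by
      conv_lhs => rw [show a - 1 = 1 + (a - 1 - 1) by ring, Real.rpow_add ht, Real.rpow_one]
    simp only [id, Pi.mul_apply, h3]
    ring

lemma hasDerivAt_vand {n : ℕ} (b : ℝ) {ε : ℝ} (hε : 0 < ε) (i : Fin n) (x : Fin n → ℝ) :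
    HasDerivAt (fun t => vand b ε (Function.update x i t))
      (vand b ε x * ∑ j, 4 * b * ((x i - x j) / ((x i - x j) ^ 2 + ε))) (x i) := by
  have hexp : ∀ y : Fin n → ℝ, vand b ε y = Real.exp
      (∑ p ∈ (Finset.univ : Finset (Fin n)).offDiag, b * Real.log ((y p.1 - y p.2) ^ 2 + ε)) := by
    intro y
    rw [Real.exp_sum]
    refine Finset.prod_congr rfl fun p _ => ?_
    rw [Real.rpow_def_of_pos (by positivity), mul_comm]
  set q : Fin n → Fin n → ℝ := fun j k => (x j - x k) / ((x j - x k) ^ 2 + ε) with hq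
  have hu : ∀ j, HasDerivAt (fun t => Function.update x i t j) (if j = i then 1 else 0) (x i) := by
    intro j
    by_cases h : j = i
    · subst h
      simpa using hasDerivAt_id' (x j)
    · simpa [h] using hasDerivAt_const (x i) (x j)
  have hs : HasDerivAt (fun t => ∑ p ∈ (Finset.univ : Finset (Fin n)).offDiag,
      b * Real.log ((Function.update x i t p.1 - Function.update x i t p.2) ^ 2 + ε))
      (∑ p ∈ (Finset.univ : Finset (Fin n)).offDiag, b * (2 * q p.1 p.2 *
        ((if p.1 = i then 1 else 0) - (if p.2 = i then 1 else 0)))) (x i) := by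
    refine HasDerivAt.fun_sum fun p _ => ?_
    have h1 := ((((hu p.1).sub (hu p.2)).pow 2).add_const ε).log (by
      simp only [Function.update_eq_self, Pi.pow_apply, Pi.sub_apply]; positivity)
    refine (h1.const_mul b).congr_deriv ?_
    simp only [Function.update_eq_self, hq, Pi.pow_apply, Pi.sub_apply]
    push_cast
    ring
  have hsum : (∑ p ∈ (Finset.univ : Finset (Fin n)).offDiag, b * (2 * q p.1 p.2 *
        ((if p.1 = i then 1 else 0) - (if p.2 = i then 1 else 0))))
      = ∑ j, 4 * b * q i j := by
    have h0 : ∀ p ∈ (Finset.univ : Finset (Fin n × Fin n)),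
        p ∉ (Finset.univ : Finset (Fin n)).offDiag → b * (2 * q p.1 p.2 *
        ((if p.1 = i then (1 : ℝ) else 0) - (if p.2 = i then 1 else 0))) = 0 := by
      intro p _ hp
      have : p.1 = p.2 := by simpa using hp
      simp [this]
    rw [Finset.sum_subset (Finset.subset_univ _) h0, ← Finset.univ_product_univ,
      Finset.sum_product]
    have hanti : ∀ j k, q j k = - q k j := by
      intro j k
      simp only [hq]
      rw [show (x j - x k) ^ 2 = (x k - x j) ^ 2 by ring]
      ring
    simp only [mul_sub, Finset.sum_sub_distrib, mul_ite, mul_one, mul_zero]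
    rw [Finset.sum_comm]
    simp only [Finset.sum_ite_eq', Finset.mem_univ, if_true]
    rw [← Finset.sum_sub_distrib]
    refine Finset.sum_congr rfl fun j _ => ?_
    rw [hanti j i]
    ring
  have := hs.exp
  simp only [← hexp] at this
  rw [Function.update_eq_self, hsum] at this
  exact this

lemma integrable_mul_vand {n : ℕ} {h : (Fin n → ℝ) → ℝ} (hm : Measurable h) (C : ℝ) (M : ℕ)
    (hh : ∀ x : Fin n → ℝ, (∀ i, 0 < x i) → |h x| ≤ C * growth x ^ M)
    {a r b ε : ℝ} (ha : 0 < a) (hr : 0 < r) (hb : 0 ≤ b) (h0 : 0 ≤ ε) (h1 : ε ≤ 1) :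
    Integrable (fun x => h x * vand b ε x * weight a r x) (orthant n) := by
  obtain ⟨M', hM'⟩ := exists_vand_le n hb
  refine integrable_of_growth (hm.mul (measurable_vand b ε)) C (M + M') (fun x hx => ?_) ha hr
  rw [Pi.mul_apply, abs_mul, abs_of_nonneg (vand_nonneg b h0 x), pow_add, ← mul_assoc]
  exact mul_le_mul (hh x hx) (hM' ε h0 h1 x hx) (vand_nonneg b h0 x)
    ((abs_nonneg _).trans (hh x hx))

/-- Passage to the limit `ε → 0` under the integral sign. -/
lemma tendsto_integral_vand {n : ℕ} {h : ℕ → (Fin n → ℝ) → ℝ} {h' : (Fin n → ℝ) → ℝ}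
    (hm : ∀ k, Measurable (h k)) (C : ℝ) (M : ℕ)
    (hh : ∀ k, ∀ x : Fin n → ℝ, (∀ i, 0 < x i) → |h k x| ≤ C * growth x ^ M)
    {a r b : ℝ} (ha : 0 < a) (hr : 0 < r) (hb : 0 ≤ b)
    {ε : ℕ → ℝ} (h0 : ∀ k, 0 ≤ ε k) (h1 : ∀ k, ε k ≤ 1)
    (hlim : ∀ x : Fin n → ℝ, (∀ i, 0 < x i) →
      Tendsto (fun k => h k x * vand b (ε k) x) atTop (𝓝 (h' x * vand b 0 x))) :
    Tendsto (fun k => ∫ x, h k x * vand b (ε k) x * weight a r x ∂(orthant n)) atTop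
      (𝓝 (∫ x, h' x * vand b 0 x * weight a r x ∂(orthant n))) := by
  obtain ⟨M', hM'⟩ := exists_vand_le n hb
  refine tendsto_integral_of_dominated_convergence
    (fun x => C * (growth x ^ (M + M') * weight a r x)) (fun k => ?_)
    ((integrable_growth (M + M') ha hr).const_mul C) (fun k => ?_) ?_
  · exact (((hm k).mul (measurable_vand b (ε k))).mul (measurable_weight a r)).aestronglyMeasurable
  · filter_upwards [ae_orthant_pos n] with x hx
    rw [norm_mul, norm_mul, Real.norm_eq_abs, Real.norm_of_nonneg (vand_nonneg b (h0 k) x),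
      Real.norm_of_nonneg (weight_pos a r hx).le, pow_add, ← mul_assoc, ← mul_assoc]
    refine mul_le_mul_of_nonneg_right ?_ (weight_pos a r hx).le
    exact mul_le_mul (hh k x hx) (hM' _ (h0 k) (h1 k) x hx) (vand_nonneg b (h0 k) x)
      ((abs_nonneg _).trans (hh k x hx))
  · filter_upwards [ae_orthant_pos n] with x hx
    exact (hlim x hx).mul_const _

lemma tendsto_vand {n : ℕ} {b : ℝ} (hb : 0 ≤ b) {ε : ℕ → ℝ} (hε : Tendsto ε atTop (𝓝 0))
    (x : Fin n → ℝ) : Tendsto (fun k => vand b (ε k) x) atTop (𝓝 (vand b 0 x)) := by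
  refine tendsto_finsetProd _ fun p _ => ?_
  exact (Real.continuousAt_rpow_const _ b (Or.inr hb)).tendsto.comp (tendsto_const_nhds.add hε)

lemma vand_zero_of_eq {n : ℕ} {b : ℝ} (hb : 0 < b) {x : Fin n → ℝ} {i j : Fin n} (hij : i ≠ j)
    (h : x i = x j) : vand b 0 x = 0 := by
  refine Finset.prod_eq_zero (i := (i, j)) (by simpa using hij) ?_
  simp [h, Real.zero_rpow hb.ne']

/-- The regularised interaction `(x_i - x_j) / ((x_i - x_j)² + ε)`. -/
noncomputable def interaction {n : ℕ} (ε : ℝ) (i j : Fin n) (x : Fin n → ℝ) : ℝ :=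
  (x i - x j) / ((x i - x j) ^ 2 + ε)

lemma measurable_interaction {n : ℕ} (ε : ℝ) (i j : Fin n) : Measurable (interaction ε i j) := by
  unfold interaction
  fun_prop

lemma interaction_symm {n : ℕ} (ε : ℝ) (i j : Fin n) (x : Fin n → ℝ) :
    interaction ε i j x = - interaction ε j i x := by
  rw [interaction, interaction, show (x i - x j) ^ 2 = (x j - x i) ^ 2 by ring]
  ring

lemma interaction_swap {n : ℕ} (ε : ℝ) (i j : Fin n) (x : Fin n → ℝ) :
    interaction ε i j (x ∘ Equiv.swap i j) = - interaction ε i j x := by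
  rw [interaction_symm ε i j x]
  simp [interaction]

lemma abs_interaction_le {n : ℕ} {ε : ℝ} (h0 : 0 < ε) (h1 : ε ≤ 1) (i j : Fin n) (x : Fin n → ℝ) :
    |interaction ε i j x| ≤ 1 / ε := by
  have hp : 0 < (x i - x j) ^ 2 + ε := by positivity
  rw [interaction, abs_div, abs_of_pos hp, div_le_div_iff₀ hp h0, one_mul, ← sq_abs (x i - x j)]
  nlinarith [sq_nonneg (|x i - x j| - ε / 2), abs_nonneg (x i - x j)]

lemma prod_swap_of_notMem {n : ℕ} {S : Finset (Fin n)} {i j : Fin n} (hi : i ∉ S) (hj : j ∉ S)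
    (x : Fin n → ℝ) : ∏ k ∈ S, (x ∘ Equiv.swap i j) k = ∏ k ∈ S, x k := by
  refine Finset.prod_congr rfl fun k hk => ?_
  rw [Function.comp_apply, Equiv.swap_apply_of_ne_of_ne] <;> rintro rfl <;> contradiction

lemma prod_swap_of_mem {n : ℕ} {S : Finset (Fin n)} {i j : Fin n} (hi : i ∈ S) (hj : j ∈ S)
    (x : Fin n → ℝ) : ∏ k ∈ S, (x ∘ Equiv.swap i j) k = ∏ k ∈ S, x k := by
  refine Finset.prod_equiv (Equiv.swap i j) (fun k => ?_) fun k _ => rfl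
  by_cases h1 : k = i
  · subst h1; simp [hi, hj]
  by_cases h2 : k = j
  · subst h2; simp [hi, hj]
  rw [Equiv.swap_apply_of_ne_of_ne h1 h2]

lemma measurable_prod_coord {n : ℕ} (S : Finset (Fin n)) :
    Measurable fun x : Fin n → ℝ => ∏ k ∈ S, x k := by
  fun_prop

section Recursion

variable {n : ℕ} {a r b : ℝ}

lemma integral_interaction_of_mem (ε : ℝ) {S : Finset (Fin n)} {i j : Fin n} (hi : i ∉ S)
    (hj : j ∈ S) :
    ∫ x, x i * (∏ k ∈ S, x k) * interaction ε i j x * vand b ε x * weight a r x ∂(orthant n)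
      = 0 := by
  have h := integral_orthant_perm (Equiv.swap i j) fun x : Fin n → ℝ =>
    x i * (∏ k ∈ S, x k) * interaction ε i j x * vand b ε x * weight a r x
  simp only [← Finset.prod_insert hi, vand_perm, weight_perm, interaction_swap,
    prod_swap_of_mem (Finset.mem_insert_self i S) (Finset.mem_insert_of_mem hj), mul_neg,
    neg_mul, integral_neg] at h ⊢
  linarith

lemma integral_interaction_of_notMem (ha : 0 < a) (hr : 0 < r) (hb : 0 ≤ b) {ε : ℝ} (h0 : 0 < ε)
    (h1 : ε ≤ 1) {S : Finset (Fin n)} {i j : Fin n} (hi : i ∉ S) (hj : j ∉ S) :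
    ∫ x, x i * (∏ k ∈ S, x k) * interaction ε i j x * vand b ε x * weight a r x ∂(orthant n)
      = 1 / 2 * ∫ x, (∏ k ∈ S, x k) * ((x i - x j) * interaction ε i j x) * vand b ε x
          * weight a r x ∂(orthant n) := by
  have h := integral_orthant_perm (Equiv.swap i j) fun x : Fin n → ℝ =>
    x i * (∏ k ∈ S, x k) * interaction ε i j x * vand b ε x * weight a r x
  simp only [vand_perm, weight_perm, interaction_swap, prod_swap_of_notMem hi hj] at h
  simp only [Function.comp_apply, Equiv.swap_apply_left] at h
  have hint : ∀ l : Fin n, Integrable (fun x => x l * (∏ k ∈ S, x k) * interaction ε i j x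
      * vand b ε x * weight a r x) (orthant n) := by
    intro l
    refine integrable_mul_vand (h := fun x => x l * (∏ k ∈ S, x k) * interaction ε i j x)
      (((measurable_pi_apply l).mul (measurable_prod_coord S)).mul
        (measurable_interaction ε i j)) (1 / ε) 2 (fun x hx => ?_) ha hr hb h0.le h1
    rw [abs_mul, abs_mul, abs_of_pos (hx l), mul_comm, sq]
    exact mul_le_mul (abs_interaction_le h0 h1 i j x)
      (mul_le_mul (coord_le_growth hx l) (abs_prod_le_growth hx S) (abs_nonneg _)
        (zero_le_one.trans (one_le_growth hx)))
      (mul_nonneg (hx l).le (abs_nonneg _)) (by positivity)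
  have h2 : ∫ x, (∏ k ∈ S, x k) * ((x i - x j) * interaction ε i j x) * vand b ε x
          * weight a r x ∂(orthant n)
      = (∫ x, x i * (∏ k ∈ S, x k) * interaction ε i j x * vand b ε x * weight a r x ∂(orthant n))
        - ∫ x, x j * (∏ k ∈ S, x k) * interaction ε i j x * vand b ε x * weight a r x
          ∂(orthant n) := by
    rw [← integral_sub (hint i) (hint j)]
    congr 1 with x
    ring
  have h3 : ∫ x, x j * (∏ k ∈ S, x k) * -interaction ε i j x * vand b ε x * weight a r x
          ∂(orthant n) = - ∫ x, x j * (∏ k ∈ S, x k) * interaction ε i j x * vand b ε x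
            * weight a r x ∂(orthant n) := by
    rw [← integral_neg]
    congr 1 with x
    ring
  linarith

lemma abs_sub_mul_interaction_le {ε : ℝ} (h0 : 0 < ε) (i j : Fin n) (x : Fin n → ℝ) :
    |(x i - x j) * interaction ε i j x| ≤ 1 := by
  have hp : 0 < (x i - x j) ^ 2 + ε := by positivity
  rw [interaction, mul_div_assoc', ← sq, abs_of_nonneg (by positivity), div_le_one hp]
  linarith

/-- The regularised Aomoto identity. -/
lemma aomoto_regularised (ha : 0 < a) (hr : 0 < r) (hb : 0 ≤ b) {ε : ℝ} (h0 : 0 < ε)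
    (h1 : ε ≤ 1) {S : Finset (Fin n)} {i : Fin n} (hi : i ∉ S) :
    ∫ x, ((a - r * x i) * ∏ k ∈ S, x k) * vand b ε x * weight a r x ∂(orthant n)
      + ∑ j ∈ (insert i S)ᶜ, 2 * b * ∫ x, (∏ k ∈ S, x k) * ((x i - x j) * interaction ε i j x)
          * vand b ε x * weight a r x ∂(orthant n) = 0 := by
  have hP : ∀ x : Fin n → ℝ, ∀ t, ∏ k ∈ S, Function.update x i t k = ∏ k ∈ S, x k := by
    intro x t
    refine Finset.prod_congr rfl fun k hk => Function.update_of_ne ?_ _ _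
    rintro rfl
    exact hi hk
  have hF1 : Integrable (fun x : Fin n → ℝ => ((a - r * x i) * ∏ k ∈ S, x k) * vand b ε x
      * weight a r x) (orthant n) := by
    refine integrable_mul_vand (h := fun x => (a - r * x i) * ∏ k ∈ S, x k)
      (by fun_prop) (a + r) 2 (fun x hx => ?_) ha hr hb h0.le h1
    have hg := one_le_growth hx
    have hc := coord_le_growth hx i
    have hxi := hx i
    rw [abs_mul, sq, ← mul_assoc]
    refine mul_le_mul ?_ (abs_prod_le_growth hx S) (abs_nonneg _) (by positivity)
    rw [abs_le]
    constructor <;> nlinarith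
  have hF2 : ∀ j : Fin n, Integrable (fun x : Fin n → ℝ => x i * (∏ k ∈ S, x k)
      * interaction ε i j x * vand b ε x * weight a r x) (orthant n) := by
    intro j
    refine integrable_mul_vand (h := fun x => x i * (∏ k ∈ S, x k) * interaction ε i j x)
      (((measurable_pi_apply i).mul (measurable_prod_coord S)).mul
        (measurable_interaction ε i j)) (1 / ε) 2 (fun x hx => ?_) ha hr hb h0.le h1
    rw [abs_mul, abs_mul, abs_of_pos (hx i), mul_comm, sq]
    exact mul_le_mul (abs_interaction_le h0 h1 i j x)
      (mul_le_mul (coord_le_growth hx i) (abs_prod_le_growth hx S) (abs_nonneg _)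
        (zero_le_one.trans (one_le_growth hx)))
      (mul_nonneg (hx i).le (abs_nonneg _)) (by positivity)
  have hF3 : Integrable (fun x : Fin n → ℝ => x i * ((∏ k ∈ S, x k) * vand b ε x)
      * weight a r x) (orthant n) := by
    have := integrable_mul_vand (h := fun x : Fin n → ℝ => x i * ∏ k ∈ S, x k)
      (by fun_prop) 1 2 (fun x hx => ?_) ha hr hb h0.le h1
    · refine this.congr (Eventually.of_forall fun x => ?_)
      simp only [mul_assoc]
    · rw [abs_mul, abs_of_pos (hx i), sq, one_mul]
      exact mul_le_mul (coord_le_growth hx i) (abs_prod_le_growth hx S) (abs_nonneg _)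
        (zero_le_one.trans (one_le_growth hx))
  have hsplit : ∀ x : Fin n → ℝ, ((a - r * x i) * ((∏ k ∈ S, x k) * vand b ε x)
      + x i * ((∏ k ∈ S, x k) * (vand b ε x * ∑ j, 4 * b * ((x i - x j) / ((x i - x j) ^ 2 + ε)))))
        * weight a r x
      = ((a - r * x i) * ∏ k ∈ S, x k) * vand b ε x * weight a r x
        + ∑ j, 4 * b * (x i * (∏ k ∈ S, x k) * interaction ε i j x * vand b ε x
          * weight a r x) := by
    intro x
    simp only [interaction, Finset.mul_sum, Finset.sum_mul, add_mul]
    congr 1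
    · ring
    · exact Finset.sum_congr rfl fun j _ => by ring
  have hF4 : Integrable (fun x : Fin n → ℝ => ∑ j, 4 * b * (x i * (∏ k ∈ S, x k)
      * interaction ε i j x * vand b ε x * weight a r x)) (orthant n) :=
    integrable_finsetSum _ fun j _ => (hF2 j).const_mul _
  have key := integral_stein i ha (F := fun x => (∏ k ∈ S, x k) * vand b ε x)
    (F' := fun x => (∏ k ∈ S, x k) * (vand b ε x * ∑ j, 4 * b * ((x i - x j) /
      ((x i - x j) ^ 2 + ε)))) (r := r) hF3 ((hF1.add hF4).congr
        (Eventually.of_forall fun x => (hsplit x).symm))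
      (fun x => by
        simp only [hP]
        exact (hasDerivAt_vand b h0 i x).const_mul _)
  simp only [hsplit] at key
  rw [integral_add hF1 hF4, integral_finsetSum _ fun j _ => (hF2 j).const_mul _] at key
  rw [← key]
  congr 1
  have hz : ∀ j ∈ (Finset.univ : Finset (Fin n)), j ∉ (insert i S)ᶜ →
      ∫ x, 4 * b * (x i * (∏ k ∈ S, x k) * interaction ε i j x * vand b ε x * weight a r x)
        ∂(orthant n) = 0 := by
    intro j _ hj
    rw [integral_const_mul]
    rw [Finset.mem_compl, not_not, Finset.mem_insert] at hj
    rcases hj with rfl | hj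
    · simp [interaction]
    · rw [integral_interaction_of_mem ε hi hj, mul_zero]
  rw [← Finset.sum_subset (Finset.subset_univ _) hz]
  refine Finset.sum_congr rfl fun j hj => ?_
  rw [Finset.mem_compl, Finset.mem_insert, not_or] at hj
  rw [integral_const_mul, integral_interaction_of_notMem ha hr hb h0 h1 hi hj.2]
  ring

/-- The integral of `∏_{k ∈ S} x_k` against the Laguerre density. -/
noncomputable def aomotoIntegral (b a r : ℝ) (S : Finset (Fin n)) : ℝ :=
  ∫ x, (∏ k ∈ S, x k) * vand b 0 x * weight a r x ∂(orthant n)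

lemma integrable_prod_mul_vand (ha : 0 < a) (hr : 0 < r) (hb : 0 ≤ b) (S : Finset (Fin n)) :
    Integrable (fun x => (∏ k ∈ S, x k) * vand b 0 x * weight a r x) (orthant n) :=
  integrable_mul_vand (measurable_prod_coord S) 1 1
    (fun x hx => by simpa using abs_prod_le_growth hx S) ha hr hb le_rfl zero_le_one

lemma aomotoIntegral_insert (ha : 0 < a) (hr : 0 < r) (hb : 0 < b) {S : Finset (Fin n)}
    {i : Fin n} (hi : i ∉ S) :
    r * aomotoIntegral b a r (insert i S)
      = (a + 2 * b * (n - 1 - S.card)) * aomotoIntegral b a r S := by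
  set ε : ℕ → ℝ := fun k => 1 / ((k : ℝ) + 1) with hε
  have hε0 : ∀ k, 0 < ε k := fun k => by positivity
  have hε1 : ∀ k, ε k ≤ 1 := fun k => by
    rw [hε, div_le_one (by positivity)]
    linarith [(Nat.cast_nonneg k : (0 : ℝ) ≤ k)]
  have hεlim : Tendsto ε atTop (𝓝 0) := tendsto_one_div_add_atTop_nhds_zero_nat
  have L1 := tendsto_integral_vand (n := n) (h := fun _ x => (a - r * x i) * ∏ k ∈ S, x k)
    (h' := fun x => (a - r * x i) * ∏ k ∈ S, x k) (fun k => by fun_prop) (a + r) 2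
    (fun k x hx => by
      have hg := one_le_growth hx
      have hc := coord_le_growth hx i
      have hxi := hx i
      rw [abs_mul, sq, ← mul_assoc]
      refine mul_le_mul ?_ (abs_prod_le_growth hx S) (abs_nonneg _) (by positivity)
      rw [abs_le]
      constructor <;> nlinarith) ha hr hb.le (fun k => (hε0 k).le) hε1
    (fun x _ => (tendsto_vand hb.le hεlim x).const_mul _)
  have L2 : ∀ j ∈ (insert i S)ᶜ, Tendsto (fun k => 2 * b * ∫ x, (∏ k ∈ S, x k) *
      ((x i - x j) * interaction (ε k) i j x) * vand b (ε k) x * weight a r x ∂(orthant n)) atTop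
      (𝓝 (2 * b * aomotoIntegral b a r S)) := by
    intro j hj
    rw [Finset.mem_compl, Finset.mem_insert, not_or] at hj
    refine Tendsto.const_mul _ ?_
    refine tendsto_integral_vand
      (h := fun k x => (∏ k ∈ S, x k) * ((x i - x j) * interaction (ε k) i j x))
      (fun k => (measurable_prod_coord S).mul
        (((measurable_pi_apply i).sub (measurable_pi_apply j)).mul
          (measurable_interaction _ i j))) 1 1 (fun k x hx => ?_) ha hr hb.le
      (fun k => (hε0 k).le) hε1 (fun x _ => ?_)
    · rw [abs_mul, pow_one, mul_comm]
      exact mul_le_mul (abs_sub_mul_interaction_le (hε0 k) i j x) (abs_prod_le_growth hx S)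
        (abs_nonneg _) zero_le_one
    · by_cases hx : x i = x j
      · rw [vand_zero_of_eq hb (Ne.symm hj.1) hx]
        simp [hx]
      · refine Tendsto.mul ?_ (tendsto_vand hb.le hεlim x)
        have hne : (x i - x j) ^ 2 + 0 ≠ 0 := by
          rw [add_zero]; exact pow_ne_zero 2 (sub_ne_zero.2 hx)
        have h1 : Tendsto (fun k => (x i - x j) * ((x i - x j) / ((x i - x j) ^ 2 + ε k))) atTop
            (𝓝 ((x i - x j) * ((x i - x j) / ((x i - x j) ^ 2 + 0)))) :=
          (tendsto_const_nhds.div (tendsto_const_nhds.add hεlim) hne).const_mul _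
        have h2 : (x i - x j) * ((x i - x j) / ((x i - x j) ^ 2 + 0)) = 1 := by
          have := sub_ne_zero.2 hx
          field_simp
          ring
        rw [h2] at h1
        simpa [interaction] using h1.const_mul (∏ k ∈ S, x k)
  have L := L1.add (tendsto_finsetSum _ L2)
  have hlim := tendsto_nhds_unique L (tendsto_const_nhds.congr fun k =>
    (aomoto_regularised ha hr hb.le (hε0 k) (hε1 k) hi).symm)
  have hcard : (((insert i S)ᶜ.card : ℕ) : ℝ) = n - 1 - S.card := by
    have h1 := Finset.card_insert_of_notMem hi
    have h2 : (insert i S).card ≤ n := by simpa using Finset.card_le_univ (insert i S)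
    rw [Finset.card_compl, Fintype.card_fin, Nat.cast_sub h2, h1]
    push_cast
    ring
  rw [Finset.sum_const, nsmul_eq_mul, hcard] at hlim
  have hsplit : ∫ x, ((a - r * x i) * ∏ k ∈ S, x k) * vand b 0 x * weight a r x ∂(orthant n)
      = a * aomotoIntegral b a r S - r * aomotoIntegral b a r (insert i S) := by
    rw [aomotoIntegral, aomotoIntegral, ← integral_const_mul, ← integral_const_mul,
      ← integral_sub ((integrable_prod_mul_vand ha hr hb.le S).const_mul a)
        ((integrable_prod_mul_vand ha hr hb.le _).const_mul r)]
    congr 1 with x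
    rw [Finset.prod_insert hi]
    ring
  rw [hsplit] at hlim
  linarith

/-- The Laguerre partition function as a function of the exponent. -/
noncomputable def laguerreIntegral (n : ℕ) (b a r : ℝ) : ℝ :=
  ∫ x, vand b 0 x * weight a r x ∂(orthant n)

lemma aomotoIntegral_eq (ha : 0 < a) (hr : 0 < r) (hb : 0 < b) (S : Finset (Fin n)) :
    aomotoIntegral b a r S
      = (∏ s ∈ Finset.range S.card, ((a + 2 * b * (n - 1 - s)) / r)) * laguerreIntegral n b a r := by
  induction S using Finset.induction_on with
  | empty => simp [aomotoIntegral, laguerreIntegral]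
  | insert i S hi ih =>
    have h := aomotoIntegral_insert ha hr hb hi
    rw [Finset.card_insert_of_notMem hi, Finset.prod_range_succ]
    have : aomotoIntegral b a r (insert i S)
        = (a + 2 * b * (n - 1 - S.card)) / r * aomotoIntegral b a r S := by
      field_simp
      linarith
    rw [this, ih]
    ring

/-- Aomoto's recursion for the Laguerre partition function. -/
theorem laguerreIntegral_add_one (ha : 0 < a) (hr : 0 < r) (hb : 0 < b) :
    laguerreIntegral n b (a + 1) r
      = (∏ j ∈ Finset.range n, ((a + 2 * b * j) / r)) * laguerreIntegral n b a r := by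
  have h := aomotoIntegral_eq ha hr hb (Finset.univ : Finset (Fin n))
  rw [Finset.card_univ, Fintype.card_fin] at h
  have h1 : laguerreIntegral n b (a + 1) r = aomotoIntegral b a r (Finset.univ : Finset (Fin n)) := by
    refine integral_congr_ae ?_
    filter_upwards [ae_orthant_pos n] with x hx
    rw [weight_add_one a r hx]
    ring
  rw [h1, h]
  congr 1
  rw [← Finset.prod_range_reflect]
  refine Finset.prod_congr rfl fun j hj => ?_
  have hj' := Finset.mem_range.1 hj
  have : ((n - 1 - j : ℕ) : ℝ) = n - 1 - j := by
    rw [Nat.cast_sub (by omega), Nat.cast_sub (by omega), Nat.cast_one]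
  rw [this]
  ring

end Recursion

/-! ### Integral representations of the digamma and trigamma functions -/

lemma differentiableAt_log_Gamma {x : ℝ} (hx : 0 < x) :
    DifferentiableAt ℝ (fun y => Real.log (Real.Gamma y)) x :=
  (Real.differentiableAt_Gamma fun m => by
    have : (0 : ℝ) ≤ m := m.cast_nonneg
    linarith).log (Real.Gamma_pos_of_pos hx).ne'

lemma log_Gamma_add_one {x : ℝ} (hx : 0 < x) :
    Real.log (Real.Gamma (x + 1)) = Real.log (Real.Gamma x) + Real.log x := by
  rw [Real.Gamma_add_one hx.ne', Real.log_mul hx.ne' (Real.Gamma_pos_of_pos hx).ne', add_comm]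

lemma polygamma_zero : polygamma 0 = deriv fun y => Real.log (Real.Gamma y) := by
  funext x
  rw [polygamma, zero_add, iteratedDeriv_one]

lemma polygamma_one (x : ℝ) : polygamma 1 x = deriv (polygamma 0) x := by
  rw [polygamma_zero, polygamma, iteratedDeriv_succ, iteratedDeriv_one]

lemma hasDerivAt_log_Gamma {x : ℝ} (hx : 0 < x) :
    HasDerivAt (fun y => Real.log (Real.Gamma y)) (polygamma 0 x) x := by
  rw [polygamma_zero]
  exact (differentiableAt_log_Gamma hx).hasDerivAt

lemma polygamma_zero_add_one {x : ℝ} (hx : 0 < x) :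
    polygamma 0 (x + 1) = polygamma 0 x + 1 / x := by
  have h1 : HasDerivAt (fun y => Real.log (Real.Gamma (y + 1))) (polygamma 0 (x + 1)) x :=
    (hasDerivAt_log_Gamma (by linarith : 0 < x + 1)).comp_add_const x 1
  have h2 : HasDerivAt (fun y => Real.log (Real.Gamma y) + Real.log y)
      (polygamma 0 x + x⁻¹) x := (hasDerivAt_log_Gamma hx).add (Real.hasDerivAt_log hx.ne')
  rw [one_div]
  refine h1.unique (h2.congr_of_eventuallyEq ?_)
  filter_upwards [eventually_gt_nhds hx] with y hy using log_Gamma_add_one hy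

lemma log_le_polygamma_zero {x : ℝ} (hx : 0 < x) : Real.log x ≤ polygamma 0 (x + 1) := by
  have hd := differentiableAt_log_Gamma (x := x + 1) (by linarith)
  have h := Real.convexOn_log_Gamma.slope_le_deriv (x := x) (y := x + 1) hx
    (by simp only [Set.mem_Ioi]; linarith) (by linarith) hd
  rw [slope_def_field, Function.comp_apply, Function.comp_apply, log_Gamma_add_one hx] at h
  rw [polygamma_zero]
  simpa [Function.comp_def] using h

lemma polygamma_zero_le_log {x : ℝ} (hx : 0 < x) : polygamma 0 x ≤ Real.log x := by
  have hd := differentiableAt_log_Gamma hx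
  have h := Real.convexOn_log_Gamma.deriv_le_slope (x := x) (y := x + 1) hx
    (by simp only [Set.mem_Ioi]; linarith) (by linarith) hd
  rw [slope_def_field, Function.comp_apply, Function.comp_apply, log_Gamma_add_one hx] at h
  rw [polygamma_zero]
  simpa [Function.comp_def] using h

/-- Binet's kernel `1 / (1 - e^{-t}) - 1 / t`. -/
noncomputable def binetKernel (t : ℝ) : ℝ := (1 - Real.exp (-t))⁻¹ - t⁻¹

/-- Binet's integral `∫₀^∞ (1 / (1 - e^{-t}) - 1 / t) e^{-xt} dt`. -/
noncomputable def binetIntegral (x : ℝ) : ℝ :=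
  ∫ t in Set.Ioi (0 : ℝ), binetKernel t * Real.exp (-x * t)

lemma one_sub_exp_neg_pos {t : ℝ} (ht : 0 < t) : 0 < 1 - Real.exp (-t) := by
  have : Real.exp (-t) < 1 := by simpa using ht
  linarith

lemma exp_sub_one_pos {t : ℝ} (ht : 0 < t) : 0 < Real.exp t - 1 := by
  have := Real.one_lt_exp_iff.2 ht
  linarith

lemma inv_one_sub_exp_neg {t : ℝ} (ht : 0 < t) :
    (1 - Real.exp (-t))⁻¹ = 1 + (Real.exp t - 1)⁻¹ := by
  have h := (exp_sub_one_pos ht).ne'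
  have h' := (Real.exp_pos t).ne'
  rw [Real.exp_neg]
  field_simp
  ring

lemma binetKernel_nonneg {t : ℝ} (ht : 0 < t) : 0 ≤ binetKernel t := by
  rw [binetKernel, sub_nonneg]
  refine inv_anti₀ (one_sub_exp_neg_pos ht) ?_
  linarith [Real.add_one_le_exp (-t)]

lemma binetKernel_le_one {t : ℝ} (ht : 0 < t) : binetKernel t ≤ 1 := by
  have : (Real.exp t - 1)⁻¹ ≤ t⁻¹ := inv_anti₀ ht (by linarith [Real.add_one_le_exp t])
  rw [binetKernel, inv_one_sub_exp_neg ht]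
  linarith

lemma measurable_binetKernel : Measurable binetKernel := by
  unfold binetKernel
  fun_prop

lemma integrableOn_exp_neg {x : ℝ} (hx : 0 < x) :
    IntegrableOn (fun t : ℝ => Real.exp (-x * t)) (Set.Ioi 0) :=
  integrableOn_exp_mul_Ioi (by linarith) 0

lemma integral_exp_neg_mul {x : ℝ} (hx : 0 < x) :
    ∫ t in Set.Ioi (0 : ℝ), Real.exp (-x * t) = 1 / x := by
  rw [integral_exp_mul_Ioi (by linarith)]
  simp

lemma integrableOn_id_mul_exp_neg {x : ℝ} (hx : 0 < x) :
    IntegrableOn (fun t : ℝ => t * Real.exp (-x * t)) (Set.Ioi 0) := by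
  have := integrableOn_rpow_mul_exp_neg_mul_rpow (p := 1) (s := 1) (by norm_num) one_pos hx
  simpa using this

lemma integrableOn_binet {x : ℝ} (hx : 0 < x) :
    IntegrableOn (fun t => binetKernel t * Real.exp (-x * t)) (Set.Ioi 0) := by
  refine (integrableOn_exp_neg hx).mono'
    (measurable_binetKernel.mul (by fun_prop)).aestronglyMeasurable ?_
  filter_upwards [ae_restrict_mem measurableSet_Ioi] with t ht
  rw [norm_mul, Real.norm_of_nonneg (binetKernel_nonneg ht), Real.norm_of_nonneg (Real.exp_pos _).le]
  exact mul_le_of_le_one_left (Real.exp_pos _).le (binetKernel_le_one ht)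

lemma binetIntegral_nonneg (x : ℝ) : 0 ≤ binetIntegral x :=
  setIntegral_nonneg measurableSet_Ioi fun _ ht =>
    mul_nonneg (binetKernel_nonneg ht) (Real.exp_pos _).le

lemma binetIntegral_le {x : ℝ} (hx : 0 < x) : binetIntegral x ≤ 1 / x := by
  rw [← integral_exp_neg_mul hx]
  refine setIntegral_mono_on (integrableOn_binet hx) (integrableOn_exp_neg hx) measurableSet_Ioi
    fun t ht => ?_
  exact mul_le_of_le_one_left (Real.exp_pos _).le (binetKernel_le_one ht)

lemma integrableOn_frullani {x : ℝ} (hx : 0 < x) :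
    IntegrableOn (fun t : ℝ => t⁻¹ * (Real.exp (-(x * t)) - Real.exp (-((x + 1) * t))))
      (Set.Ioi 0) := by
  refine (integrableOn_exp_neg hx).mono' (by fun_prop) ?_
  filter_upwards [ae_restrict_mem measurableSet_Ioi] with t ht
  have ht' : 0 < t := ht
  have h1 : Real.exp (-((x + 1) * t)) = Real.exp (-x * t) * Real.exp (-t) := by
    rw [← Real.exp_add]; ring_nf
  have h2 := one_sub_exp_neg_pos ht'
  have h3 := Real.add_one_le_exp (-t)
  have h4 := Real.exp_pos (-x * t)
  rw [h1, ← neg_mul, ← mul_one_sub, Real.norm_of_nonneg (by positivity), inv_mul_le_iff₀ ht', mul_comm t]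
  exact mul_le_mul_of_nonneg_left (by linarith) h4.le

lemma integral_frullani {x : ℝ} (hx : 0 < x) :
    ∫ t in Set.Ioi (0 : ℝ), t⁻¹ * (Real.exp (-(x * t)) - Real.exp (-((x + 1) * t)))
      = Real.log ((x + 1) / x) := by
  have h := Frullani.integral_Ioi_eq (f := fun t : ℝ => Real.exp (-t)) (a := x) (b := x + 1)
    (L := 1) (R := 0) (ContinuousOn.locallyIntegrableOn (by fun_prop) measurableSet_Ioi) hx
    (by linarith) (by
      have : Tendsto (fun t : ℝ => Real.exp (-t)) (𝓝 0) (𝓝 (Real.exp (-0))) :=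
        (by fun_prop : Continuous fun t : ℝ => Real.exp (-t)).tendsto 0
      simpa using this.mono_left nhdsWithin_le_nhds)
    (Real.tendsto_exp_neg_atTop_nhds_zero) (integrableOn_frullani hx)
  simpa using h

lemma binetIntegral_sub {x : ℝ} (hx : 0 < x) :
    binetIntegral x - binetIntegral (x + 1) = 1 / x - Real.log ((x + 1) / x) := by
  have hx1 : 0 < x + 1 := by linarith
  rw [binetIntegral, binetIntegral, ← integral_sub (integrableOn_binet hx) (integrableOn_binet hx1),
    ← integral_frullani hx, ← integral_exp_neg_mul hx,
    ← integral_sub (integrableOn_exp_neg hx) (integrableOn_frullani hx)]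
  refine setIntegral_congr_fun measurableSet_Ioi fun t ht => ?_
  have h1 : Real.exp (-(x + 1) * t) = Real.exp (-x * t) * Real.exp (-t) := by
    rw [← Real.exp_add]; ring_nf
  have h2 := (one_sub_exp_neg_pos ht).ne'
  simp only [binetKernel, ← neg_mul, h1]
  field_simp

/-- Binet's formula for the digamma function. -/
theorem polygamma_zero_eq {x : ℝ} (hx : 0 < x) :
    polygamma 0 x = Real.log x - binetIntegral x := by
  set D : ℝ → ℝ := fun y => polygamma 0 y - Real.log y + binetIntegral y with hD
  have hper : ∀ y, 0 < y → D (y + 1) = D y := by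
    intro y hy
    have h1 := binetIntegral_sub hy
    rw [Real.log_div (by linarith) hy.ne'] at h1
    simp only [hD, polygamma_zero_add_one hy]
    linarith
  have hperN : ∀ N : ℕ, D (x + N) = D x := by
    intro N
    induction N with
    | zero => simp
    | succ N ih => rw [← ih, ← hper (x + N) (by positivity)]; push_cast; ring_nf
  have hbound : ∀ y, 0 < y → |D (y + 1)| ≤ 1 / y := by
    intro y hy
    have h1 := log_le_polygamma_zero hy
    have h2 := polygamma_zero_le_log (x := y + 1) (by linarith)
    have h3 := binetIntegral_nonneg (y + 1)
    have h4 := binetIntegral_le (x := y + 1) (by linarith)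
    have h5 : 1 / (y + 1) ≤ 1 / y := one_div_le_one_div_of_le hy (by linarith)
    have h6 : Real.log (y + 1) - Real.log y ≤ 1 / y := by
      rw [← Real.log_div (by linarith) hy.ne']
      refine (Real.log_le_sub_one_of_pos (by positivity)).trans (le_of_eq ?_)
      field_simp
      ring
    rw [abs_le]
    constructor <;> simp only [hD] <;> linarith
  have hlim : Tendsto (fun N : ℕ => 1 / (x + N)) atTop (𝓝 0) :=
    tendsto_const_nhds.div_atTop (tendsto_atTop_add_const_left _ x tendsto_natCast_atTop_atTop)
  have h0 : |D x| ≤ 0 := by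
    refine ge_of_tendsto' hlim fun N => ?_
    have := hbound (x + N) (by positivity)
    have h := hperN (N + 1)
    push_cast at h
    rw [← add_assoc] at h
    rwa [h] at this
  have := abs_nonpos_iff.1 h0
  simp only [hD] at this
  linarith

/-- The integral `∫₀^∞ t e^{-xt} / (1 - e^{-t}) dt` representing the trigamma function. -/
noncomputable def trigammaIntegral (x : ℝ) : ℝ :=
  ∫ t in Set.Ioi (0 : ℝ), t * (1 - Real.exp (-t))⁻¹ * Real.exp (-x * t)

lemma integrableOn_id_mul_binet {x : ℝ} (hx : 0 < x) :
    IntegrableOn (fun t => t * (binetKernel t * Real.exp (-x * t))) (Set.Ioi 0) := by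
  refine (integrableOn_id_mul_exp_neg hx).mono'
    (measurable_id.mul (measurable_binetKernel.mul (by fun_prop))).aestronglyMeasurable ?_
  filter_upwards [ae_restrict_mem measurableSet_Ioi] with t ht
  have ht' : 0 < t := ht
  have h1 := binetKernel_nonneg ht'
  have h2 := Real.exp_pos (-x * t)
  rw [Real.norm_of_nonneg (by positivity)]
  exact mul_le_mul_of_nonneg_left (mul_le_of_le_one_left h2.le (binetKernel_le_one ht)) ht'.le

lemma hasDerivAt_binetIntegral {x : ℝ} (hx : 0 < x) :
    HasDerivAt binetIntegral (-∫ t in Set.Ioi (0 : ℝ), t * (binetKernel t * Real.exp (-x * t)))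
      x := by
  have h := hasDerivAt_integral_of_dominated_loc_of_deriv_le
    (μ := volume.restrict (Set.Ioi (0 : ℝ))) (x₀ := x) (s := Set.Ioi (x / 2))
    (F := fun y t => binetKernel t * Real.exp (-y * t))
    (F' := fun y t => -(t * (binetKernel t * Real.exp (-y * t))))
    (bound := fun t => t * Real.exp (-(x / 2) * t))
    (Ioi_mem_nhds (by linarith))
    (Eventually.of_forall fun y => (measurable_binetKernel.mul (by fun_prop)).aestronglyMeasurable)
    (integrableOn_binet hx) (integrableOn_id_mul_binet hx).aestronglyMeasurable.neg ?_
    (integrableOn_id_mul_exp_neg (by linarith)) ?_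
  · rw [← integral_neg]
    exact h.2
  · filter_upwards [ae_restrict_mem measurableSet_Ioi] with t ht y hy
    have ht' : 0 < t := ht
    have hy' : x / 2 < y := hy
    have h1 := binetKernel_nonneg ht'
    have h2 := Real.exp_pos (-y * t)
    rw [norm_neg, Real.norm_of_nonneg (by positivity)]
    refine mul_le_mul_of_nonneg_left ((mul_le_of_le_one_left h2.le
      (binetKernel_le_one ht)).trans (Real.exp_le_exp.2 ?_)) ht'.le
    nlinarith
  · refine Eventually.of_forall fun t y _ => ?_
    have : HasDerivAt (fun y : ℝ => Real.exp (-y * t)) (Real.exp (-y * t) * (-1 * t)) y :=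
      ((hasDerivAt_id y).neg.mul_const t).exp
    refine (this.const_mul (binetKernel t)).congr_deriv ?_
    ring

lemma trigamma_kernel_eq {t : ℝ} (ht : 0 < t) (x : ℝ) :
    t * (1 - Real.exp (-t))⁻¹ * Real.exp (-x * t)
      = Real.exp (-x * t) + t * (binetKernel t * Real.exp (-x * t)) := by
  rw [binetKernel]
  field_simp
  ring

lemma integrableOn_trigamma {x : ℝ} (hx : 0 < x) :
    IntegrableOn (fun t => t * (1 - Real.exp (-t))⁻¹ * Real.exp (-x * t)) (Set.Ioi 0) :=
  ((integrableOn_exp_neg hx).add (integrableOn_id_mul_binet hx)).congr_fun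
    (fun _ ht => (trigamma_kernel_eq ht x).symm) measurableSet_Ioi

lemma hasDerivAt_polygamma_zero {x : ℝ} (hx : 0 < x) :
    HasDerivAt (polygamma 0) (trigammaIntegral x) x := by
  have h := (Real.hasDerivAt_log hx.ne').sub (hasDerivAt_binetIntegral hx)
  have h2 : x⁻¹ - -∫ t in Set.Ioi (0 : ℝ), t * (binetKernel t * Real.exp (-x * t))
      = trigammaIntegral x := by
    rw [sub_neg_eq_add, ← one_div, ← integral_exp_neg_mul hx,
      ← integral_add (integrableOn_exp_neg hx) (integrableOn_id_mul_binet hx)]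
    exact setIntegral_congr_fun measurableSet_Ioi fun t ht => (trigamma_kernel_eq ht x).symm
  rw [h2] at h
  refine h.congr_of_eventuallyEq ?_
  filter_upwards [eventually_gt_nhds hx] with y hy using polygamma_zero_eq hy

theorem polygamma_one_eq {x : ℝ} (hx : 0 < x) : polygamma 1 x = trigammaIntegral x := by
  rw [polygamma_one, (hasDerivAt_polygamma_zero hx).deriv]

lemma hasDerivAt_polygamma_zero' {x : ℝ} (hx : 0 < x) :
    HasDerivAt (polygamma 0) (polygamma 1 x) x := by
  rw [polygamma_one_eq hx]
  exact hasDerivAt_polygamma_zero hx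

lemma polygamma_zero_one : polygamma 0 1 = -Real.eulerMascheroniConstant := by
  have h := Real.hasDerivAt_Gamma_one.log (by rw [Real.Gamma_one]; exact one_ne_zero)
  rw [Real.Gamma_one, div_one] at h
  rw [polygamma_zero, h.deriv]

lemma binetIntegral_one : binetIntegral 1 = Real.eulerMascheroniConstant := by
  have h := polygamma_zero_eq one_pos
  rw [polygamma_zero_one, Real.log_one] at h
  linarith

lemma polygamma_one_add_one {x : ℝ} (hx : 0 < x) :
    polygamma 1 (x + 1) = polygamma 1 x - 1 / x ^ 2 := by
  have h1 : HasDerivAt (fun y => polygamma 0 (y + 1)) (polygamma 1 (x + 1)) x :=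
    (hasDerivAt_polygamma_zero' (by linarith : 0 < x + 1)).comp_add_const x 1
  have h2 := (hasDerivAt_polygamma_zero' hx).add (hasDerivAt_inv hx.ne')
  refine (h1.unique (h2.congr_of_eventuallyEq ?_)).trans (by ring)
  filter_upwards [eventually_gt_nhds hx] with y hy
  simp [polygamma_zero_add_one hy]

lemma polygamma_zero_reflection {x : ℝ} (h0 : 0 < x) (h1 : x < 1) :
    polygamma 0 x - polygamma 0 (1 - x) = -(Real.pi * Real.cos (Real.pi * x))
      / Real.sin (Real.pi * x) := by
  have hsin : ∀ y : ℝ, 0 < y → y < 1 → 0 < Real.sin (Real.pi * y) := fun y hy0 hy1 =>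
    Real.sin_pos_of_pos_of_lt_pi (mul_pos Real.pi_pos hy0)
      (by nlinarith [Real.pi_pos])
  have hd1 : HasDerivAt (fun y => Real.log (Real.Gamma y) + Real.log (Real.Gamma (1 - y)))
      (polygamma 0 x + -polygamma 0 (1 - x)) x :=
    (hasDerivAt_log_Gamma h0).add
      ((hasDerivAt_log_Gamma (by linarith : 0 < 1 - x)).comp_const_sub 1 x)
  have hs : HasDerivAt (fun y : ℝ => Real.sin (Real.pi * y))
      (Real.cos (Real.pi * x) * (Real.pi * 1)) x := ((hasDerivAt_id x).const_mul Real.pi).sin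
  have hd2 := (hs.log (hsin x h0 h1).ne').const_sub (Real.log Real.pi)
  refine (hd1.unique (hd2.congr_of_eventuallyEq ?_)).trans (by ring)
  filter_upwards [Ioo_mem_nhds h0 h1] with y hy
  rw [← Real.log_mul (Real.Gamma_pos_of_pos hy.1).ne'
    (Real.Gamma_pos_of_pos (by linarith [hy.2])).ne', Real.Gamma_mul_Gamma_one_sub,
    Real.log_div Real.pi_pos.ne' (hsin y hy.1 hy.2).ne']

lemma polygamma_one_one_half : polygamma 1 (1 / 2) = Real.pi ^ 2 / 2 := by
  have hhalf : (0 : ℝ) < 1 - 1 / 2 := by norm_num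
  have h1 : HasDerivAt (fun y => polygamma 0 y - polygamma 0 (1 - y))
      (polygamma 1 (1 / 2) - -polygamma 1 (1 - 1 / 2)) (1 / 2) :=
    (hasDerivAt_polygamma_zero' one_half_pos).sub
      ((hasDerivAt_polygamma_zero' hhalf).comp_const_sub 1 (1 / 2))
  have hlin : HasDerivAt (fun y : ℝ => Real.pi * y) (Real.pi * 1) (1 / 2) :=
    (hasDerivAt_id (1 / 2 : ℝ)).const_mul Real.pi
  have hsin : Real.sin (Real.pi * (1 / 2)) = 1 := by
    rw [mul_one_div, Real.sin_pi_div_two]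
  have h2 := ((hlin.cos.const_mul Real.pi).neg).div hlin.sin (by rw [hsin]; exact one_ne_zero)
  have h3 := h1.unique (h2.congr_of_eventuallyEq (by
    filter_upwards [Ioo_mem_nhds (one_half_pos : (0 : ℝ) < 1 / 2) one_half_lt_one] with y hy
    exact polygamma_zero_reflection hy.1 hy.2))
  have hcos : Real.cos (Real.pi * (1 / 2)) = 0 := by
    rw [mul_one_div, Real.cos_pi_div_two]
  rw [hsin, hcos] at h3
  norm_num at h3
  linarith

/-! ### The constant `K_β` -/

/-- The derivative of `s / (1 - e^{-s})`. -/
noncomputable def bernoulliDeriv (s : ℝ) : ℝ :=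
  (1 - Real.exp (-s) - s * Real.exp (-s)) * ((1 - Real.exp (-s)) ^ 2)⁻¹

lemma hasDerivAt_mul_binetKernel {s : ℝ} (hs : 0 < s) :
    HasDerivAt (fun s => s * binetKernel s) (bernoulliDeriv s) s := by
  have hw := (one_sub_exp_neg_pos hs).ne'
  have he : HasDerivAt (fun s : ℝ => 1 - Real.exp (-s)) (Real.exp (-s)) s :=
    ((hasDerivAt_neg s).exp.const_sub 1).congr_deriv (by ring)
  have h := ((hasDerivAt_id s).mul (he.inv hw)).sub_const 1
  refine (h.congr_of_eventuallyEq ?_).congr_deriv ?_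
  · filter_upwards [eventually_ne_nhds hs.ne'] with y hy
    simp [binetKernel, mul_sub, hy]
  · simp only [id, bernoulliDeriv, Pi.inv_apply]
    field_simp
    ring

lemma bernoulliDeriv_nonneg (s : ℝ) : 0 ≤ bernoulliDeriv s := by
  refine mul_nonneg ?_ (by positivity)
  have h : Real.exp (-s) * (1 + s) ≤ 1 := by
    rw [Real.exp_neg, inv_mul_le_iff₀ (Real.exp_pos s), mul_one]
    linarith [Real.add_one_le_exp s]
  linarith

lemma bernoulliDeriv_le_one {s : ℝ} (hs : 0 < s) : bernoulliDeriv s ≤ 1 := by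
  have hw := one_sub_exp_neg_pos hs
  rw [bernoulliDeriv, ← div_eq_mul_inv, div_le_one (by positivity)]
  nlinarith [Real.add_one_le_exp (-s), Real.exp_pos (-s)]

section LogDetConst

variable {θ : ℝ}

/-- The integrand obtained from `K_β` by adding a total derivative. -/
noncomputable def binetProduct (θ t : ℝ) : ℝ :=
  (1 + t / θ * binetKernel (t / θ)) * binetKernel t * Real.exp (-t)

/-- The derivative of `-(t/θ) / (1 - e^{-t/θ}) e^{-t}`. -/
noncomputable def boundaryDeriv (θ t : ℝ) : ℝ :=
  (1 + t / θ * binetKernel (t / θ) - bernoulliDeriv (t / θ) / θ) * Real.exp (-t)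

lemma logDetConstIntegrand_eq (hθ : 0 < θ) {t : ℝ} (ht : 0 < t) :
    2 / (2 * θ) ^ 2 * logDetConstIntegrand (2 * θ) t = binetProduct θ t - boundaryDeriv θ t := by
  have hs : 0 < t / θ := by positivity
  have e1 : Real.exp (-2 * t * (1 - 1 / (2 * θ))) = (Real.exp t ^ 2)⁻¹ * Real.exp (t / θ) := by
    rw [← Real.exp_nat_mul, ← Real.exp_neg, ← Real.exp_add]
    congr 1
    push_cast
    field_simp
    ring
  have e2 : 2 * t / (2 * θ) = t / θ := by field_simp
  have h1 := (exp_sub_one_pos ht).ne'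
  have h2 := (exp_sub_one_pos hs).ne'
  have h3 := (Real.exp_pos t).ne'
  have h4 := (Real.exp_pos (t / θ)).ne'
  rw [logDetConstIntegrand, binetProduct, boundaryDeriv, bernoulliDeriv, binetKernel, binetKernel,
    e1, e2, Real.exp_neg, Real.exp_neg]
  have h5 : (1 - (Real.exp t)⁻¹) = (Real.exp t - 1) / Real.exp t := by field_simp
  have h6 : (1 - (Real.exp (t / θ))⁻¹) = (Real.exp (t / θ) - 1) / Real.exp (t / θ) := by
    field_simp
  rw [h5, h6]
  generalize Real.exp t = E at *
  generalize Real.exp (t / θ) = q at *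
  field_simp
  ring

lemma integrableOn_linear_mul_exp_neg (c d : ℝ) :
    IntegrableOn (fun t : ℝ => (c + d * t) * Real.exp (-t)) (Set.Ioi 0) := by
  have h1 := (integrableOn_exp_neg one_pos).const_mul c
  have h2 := (integrableOn_id_mul_exp_neg one_pos).const_mul d
  refine IntegrableOn.congr_fun (h1.add h2) (fun t _ => ?_) measurableSet_Ioi
  simp only [Pi.add_apply, neg_mul, one_mul]
  ring

lemma measurable_bernoulliDeriv : Measurable bernoulliDeriv := by
  unfold bernoulliDeriv
  fun_prop

lemma mul_binetKernel_mem (hθ : 0 < θ) {t : ℝ} (ht : 0 < t) :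
    0 ≤ t / θ * binetKernel (t / θ) ∧ t / θ * binetKernel (t / θ) ≤ t / θ := by
  have hs : 0 < t / θ := by positivity
  exact ⟨mul_nonneg hs.le (binetKernel_nonneg hs),
    mul_le_of_le_one_right hs.le (binetKernel_le_one hs)⟩

lemma measurable_mul_binetKernel (θ : ℝ) : Measurable fun t => t / θ * binetKernel (t / θ) :=
  (by fun_prop : Measurable fun t : ℝ => t / θ).mul
    (measurable_binetKernel.comp (by fun_prop : Measurable fun t : ℝ => t / θ))

lemma integrableOn_binetProduct (hθ : 0 < θ) : IntegrableOn (binetProduct θ) (Set.Ioi 0) := by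
  refine (integrableOn_linear_mul_exp_neg 1 (1 / θ)).mono'
    (((measurable_const.add (measurable_mul_binetKernel θ)).mul measurable_binetKernel).mul
      (by fun_prop)).aestronglyMeasurable ?_
  filter_upwards [ae_restrict_mem measurableSet_Ioi] with t ht
  obtain ⟨h1, h2⟩ := mul_binetKernel_mem hθ ht
  have h3 := binetKernel_nonneg ht
  rw [binetProduct, Real.norm_of_nonneg (by positivity)]
  refine mul_le_mul_of_nonneg_right ?_ (Real.exp_pos _).le
  refine (mul_le_of_le_one_right (by positivity) (binetKernel_le_one ht)).trans ?_
  rw [one_div_mul_eq_div]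
  linarith

lemma integrableOn_boundaryDeriv (hθ : 0 < θ) : IntegrableOn (boundaryDeriv θ) (Set.Ioi 0) := by
  refine (integrableOn_linear_mul_exp_neg (1 + 1 / θ) (1 / θ)).mono'
    (((measurable_const.add (measurable_mul_binetKernel θ)).sub
      ((measurable_bernoulliDeriv.comp (by fun_prop : Measurable fun t : ℝ => t / θ)).div_const
        θ)).mul (by fun_prop)).aestronglyMeasurable ?_
  filter_upwards [ae_restrict_mem measurableSet_Ioi] with t ht
  have hs : 0 < t / θ := div_pos ht hθ
  obtain ⟨h1, h2⟩ := mul_binetKernel_mem hθ ht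
  have h3 : 0 ≤ bernoulliDeriv (t / θ) / θ := div_nonneg (bernoulliDeriv_nonneg _) hθ.le
  have h4 : bernoulliDeriv (t / θ) / θ ≤ 1 / θ :=
    div_le_div_of_nonneg_right (bernoulliDeriv_le_one hs) hθ.le
  have h5 : 0 ≤ 1 / θ := by positivity
  rw [boundaryDeriv, norm_mul, Real.norm_of_nonneg (Real.exp_pos _).le, Real.norm_eq_abs]
  refine mul_le_mul_of_nonneg_right ?_ (Real.exp_pos _).le
  rw [abs_le, one_div_mul_eq_div]
  constructor <;> linarith

lemma integral_boundaryDeriv (hθ : 0 < θ) : ∫ t in Set.Ioi (0 : ℝ), boundaryDeriv θ t = 1 := by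
  set F : ℝ → ℝ := fun t => -((1 + t / θ * binetKernel (t / θ)) * Real.exp (-t)) with hF
  have hder : ∀ t ∈ Set.Ioi (0 : ℝ), HasDerivAt F (boundaryDeriv θ t) t := by
    intro t ht
    have hs : 0 < t / θ := div_pos ht hθ
    have h1 : HasDerivAt (fun t => t / θ * binetKernel (t / θ)) (bernoulliDeriv (t / θ) * (1 / θ))
        t := (hasDerivAt_mul_binetKernel hs).comp (h := fun t => t / θ) t
          ((hasDerivAt_id t).div_const θ)
    have h := ((h1.const_add 1).mul (hasDerivAt_neg t).exp).neg
    refine h.congr_deriv ?_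
    rw [boundaryDeriv]
    ring
  have hbd : ∀ t ∈ Set.Ioi (0 : ℝ), |F t| ≤ (1 + t / θ) * Real.exp (-t) := by
    intro t ht
    obtain ⟨h1, h2⟩ := mul_binetKernel_mem hθ ht
    rw [hF, abs_neg, abs_mul, abs_of_pos (Real.exp_pos _), abs_of_nonneg (by linarith)]
    exact mul_le_mul_of_nonneg_right (by linarith) (Real.exp_pos _).le
  have hcont : ContinuousWithinAt F (Set.Ici 0) 0 := by
    have h0 : Tendsto (fun t => t / θ * binetKernel (t / θ)) (𝓝[Set.Ici 0] 0) (𝓝 0) := by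
      refine squeeze_zero' (g := fun t => t / θ) ?_ ?_ ?_
      · filter_upwards [self_mem_nhdsWithin] with t ht
        rcases (Set.mem_Ici.1 ht).eq_or_lt with rfl | h
        · simp
        · exact (mul_binetKernel_mem hθ h).1
      · filter_upwards [self_mem_nhdsWithin] with t ht
        rcases (Set.mem_Ici.1 ht).eq_or_lt with rfl | h
        · simp
        · exact (mul_binetKernel_mem hθ h).2
      · have : Tendsto (fun t : ℝ => t / θ) (𝓝 0) (𝓝 (0 / θ)) :=
          (by fun_prop : Continuous fun t : ℝ => t / θ).tendsto 0
        rw [zero_div] at this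
        exact this.mono_left nhdsWithin_le_nhds
    have h1 : Tendsto (fun t : ℝ => Real.exp (-t)) (𝓝[Set.Ici 0] 0) (𝓝 (Real.exp (-0))) :=
      ((by fun_prop : Continuous fun t : ℝ => Real.exp (-t)).tendsto 0).mono_left nhdsWithin_le_nhds
    have h2 := ((h0.const_add 1).mul h1).neg
    have h3 : F 0 = -((1 + 0) * Real.exp (-0)) := by simp [hF]
    rw [ContinuousWithinAt, h3]
    exact h2
  have hint : IntegrableOn F (Set.Ioi 0) := by
    refine (integrableOn_linear_mul_exp_neg 1 (1 / θ)).mono'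
      ((measurable_const.add (measurable_mul_binetKernel θ)).mul
        (by fun_prop)).neg.aestronglyMeasurable ?_
    filter_upwards [ae_restrict_mem measurableSet_Ioi] with t ht
    rw [one_div_mul_eq_div]
    exact hbd t ht
  have hlim := tendsto_zero_of_hasDerivAt_of_integrableOn_Ioi hder (integrableOn_boundaryDeriv hθ)
    hint
  rw [integral_Ioi_of_hasDerivAt_of_tendsto hcont hder (integrableOn_boundaryDeriv hθ) hlim]
  simp [hF]

lemma integrableOn_logDetConstIntegrand (hθ : 0 < θ) :
    IntegrableOn (logDetConstIntegrand (2 * θ)) (Set.Ioi 0) := by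
  have h := ((integrableOn_binetProduct hθ).sub (integrableOn_boundaryDeriv hθ)).const_mul
    ((2 * θ) ^ 2 / 2)
  refine IntegrableOn.congr_fun h (fun t ht => ?_) measurableSet_Ioi
  simp only [Pi.sub_apply]
  rw [← logDetConstIntegrand_eq hθ ht]
  field_simp

lemma logDetConst_eq (hθ : 0 < θ) :
    logDetConst (2 * θ) = (∫ t in Set.Ioi (0 : ℝ), binetProduct θ t) - 1 := by
  rw [logDetConst, ← integral_const_mul, ← integral_boundaryDeriv hθ,
    ← integral_sub (integrableOn_binetProduct hθ) (integrableOn_boundaryDeriv hθ)]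
  exact setIntegral_congr_fun measurableSet_Ioi fun t ht => logDetConstIntegrand_eq hθ ht

/-! ### Asymptotics of sums of trigamma values -/

lemma integral_Ioi_scale (hθ : 0 < θ) (g : ℝ → ℝ) :
    θ * ∫ s in Set.Ioi (0 : ℝ), g s = ∫ t in Set.Ioi (0 : ℝ), g (t / θ) := by
  have h := integral_comp_mul_left_Ioi g 0 (inv_pos.2 hθ)
  rw [mul_zero, inv_inv, smul_eq_mul] at h
  rw [← h]
  simp only [div_eq_inv_mul]

lemma integrableOn_Ioi_scale (hθ : 0 < θ) {g : ℝ → ℝ} (hg : IntegrableOn g (Set.Ioi 0)) :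
    IntegrableOn (fun t => g (t / θ)) (Set.Ioi 0) := by
  have h := (integrableOn_Ioi_comp_mul_left_iff g 0 (inv_pos.2 hθ)).2 (by rwa [mul_zero])
  simpa only [div_eq_inv_mul] using h

lemma binetIntegral_scale (hθ : 0 < θ) :
    binetIntegral θ = ∫ t in Set.Ioi (0 : ℝ), θ⁻¹ * binetKernel (t / θ) * Real.exp (-t) := by
  have h := integral_Ioi_scale hθ fun s => binetKernel s * Real.exp (-θ * s)
  rw [binetIntegral, ← mul_right_inj' hθ.ne', h, ← integral_const_mul]
  refine setIntegral_congr_fun measurableSet_Ioi fun t _ => ?_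
  have : -θ * (t / θ) = -t := by field_simp
  simp only [this]
  field_simp

lemma polygamma_one_scale (hθ : 0 < θ) {x : ℝ} (hx : 0 < x) :
    IntegrableOn (fun t => t / θ * binetKernel (t / θ) * Real.exp (-x * t)) (Set.Ioi 0) ∧
    θ * polygamma 1 (θ * x) = 1 / x
      + ∫ t in Set.Ioi (0 : ℝ), t / θ * binetKernel (t / θ) * Real.exp (-x * t) := by
  have hθx : 0 < θ * x := mul_pos hθ hx
  have he : ∀ t : ℝ, t / θ * (binetKernel (t / θ) * Real.exp (-(θ * x) * (t / θ)))
      = t / θ * binetKernel (t / θ) * Real.exp (-x * t) := by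
    intro t
    rw [mul_assoc]
    congr 3
    field_simp
  constructor
  · simpa only [he] using integrableOn_Ioi_scale hθ (integrableOn_id_mul_binet hθx)
  · have h := integral_Ioi_scale hθ fun s => s * (binetKernel s * Real.exp (-(θ * x) * s))
    simp only [he] at h
    rw [← h, polygamma_one_eq hθx, trigammaIntegral,
      setIntegral_congr_fun measurableSet_Ioi fun t ht => trigamma_kernel_eq ht (θ * x),
      integral_add (integrableOn_exp_neg hθx) (integrableOn_id_mul_binet hθx),
      integral_exp_neg_mul hθx]
    field_simp

lemma geom_partial_sum {t : ℝ} (ht : 0 < t) (n : ℕ) :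
    ∑ j ∈ Finset.range n, Real.exp (-((j : ℝ) + 1) * t)
      ≤ (1 - Real.exp (-t))⁻¹ * Real.exp (-t) ∧
    Tendsto (fun n : ℕ => ∑ j ∈ Finset.range n, Real.exp (-((j : ℝ) + 1) * t)) atTop
      (𝓝 ((1 - Real.exp (-t))⁻¹ * Real.exp (-t))) := by
  have h : HasSum (fun j : ℕ => Real.exp (-((j : ℝ) + 1) * t))
      ((1 - Real.exp (-t))⁻¹ * Real.exp (-t)) := by
    have := (hasSum_geometric_of_lt_one (Real.exp_pos (-t)).le
      (by linarith [one_sub_exp_neg_pos ht])).mul_right (Real.exp (-t))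
    refine this.congr_fun fun j => ?_
    rw [← Real.exp_nat_mul, ← Real.exp_add]
    ring_nf
  exact ⟨sum_le_hasSum _ (fun _ _ => (Real.exp_pos _).le) h, h.tendsto_sum_nat⟩

lemma tendsto_sum_polygamma_one_sub_harmonic (hθ : 0 < θ) :
    Tendsto (fun n : ℕ => (∑ j ∈ Finset.range n, θ * polygamma 1 (θ * ((j : ℝ) + 1)))
        - (harmonic n : ℝ)) atTop
      (𝓝 (∫ t in Set.Ioi (0 : ℝ), t / θ * binetKernel (t / θ)
        * ((1 - Real.exp (-t))⁻¹ * Real.exp (-t)))) := by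
  have hS : ∀ n : ℕ, (∑ j ∈ Finset.range n, θ * polygamma 1 (θ * ((j : ℝ) + 1)))
        - (harmonic n : ℝ) = ∫ t in Set.Ioi (0 : ℝ), t / θ * binetKernel (t / θ)
          * ∑ j ∈ Finset.range n, Real.exp (-((j : ℝ) + 1) * t) := by
    intro n
    simp only [Finset.mul_sum]
    rw [integral_finsetSum _ fun j _ => (polygamma_one_scale hθ (by positivity)).1,
      Finset.sum_congr rfl fun (j : ℕ) _ => (polygamma_one_scale hθ
        (by positivity : (0 : ℝ) < (j : ℝ) + 1)).2,
      Finset.sum_add_distrib, harmonic]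
    push_cast
    simp
  simp only [hS]
  have hb := (integrableOn_trigamma one_pos).const_mul θ⁻¹
  refine tendsto_integral_of_dominated_convergence _ (fun n => ?_) hb (fun n => ?_) ?_
  · exact ((measurable_mul_binetKernel θ).mul (by fun_prop)).aestronglyMeasurable
  · filter_upwards [ae_restrict_mem measurableSet_Ioi] with t ht
    obtain ⟨h1, h2⟩ := mul_binetKernel_mem hθ ht
    have h3 : 0 ≤ ∑ j ∈ Finset.range n, Real.exp (-((j : ℝ) + 1) * t) :=
      Finset.sum_nonneg fun _ _ => (Real.exp_pos _).le
    rw [Real.norm_of_nonneg (mul_nonneg h1 h3)]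
    refine (mul_le_mul h2 (geom_partial_sum ht n).1 h3 (h1.trans h2)).trans (le_of_eq ?_)
    rw [neg_mul, one_mul]
    ring
  · filter_upwards [ae_restrict_mem measurableSet_Ioi] with t ht
    exact (geom_partial_sum ht 0).2.const_mul _

lemma integral_identity (hθ : 0 < θ) :
    (∫ t in Set.Ioi (0 : ℝ), t / θ * binetKernel (t / θ)
        * ((1 - Real.exp (-t))⁻¹ * Real.exp (-t))) + binetIntegral 1
      = binetIntegral θ + ∫ t in Set.Ioi (0 : ℝ), binetProduct θ t := by
  have i1 : IntegrableOn (fun t => t / θ * binetKernel (t / θ)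
        * ((1 - Real.exp (-t))⁻¹ * Real.exp (-t))) (Set.Ioi 0) := by
    refine ((integrableOn_trigamma one_pos).const_mul θ⁻¹).mono'
      ((measurable_mul_binetKernel θ).mul (by fun_prop)).aestronglyMeasurable ?_
    filter_upwards [ae_restrict_mem measurableSet_Ioi] with t ht
    obtain ⟨h1, h2⟩ := mul_binetKernel_mem hθ ht
    have h3 : 0 ≤ (1 - Real.exp (-t))⁻¹ * Real.exp (-t) :=
      mul_nonneg (inv_nonneg.2 (one_sub_exp_neg_pos ht).le) (Real.exp_pos _).le
    rw [Real.norm_of_nonneg (mul_nonneg h1 h3)]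
    refine (mul_le_mul_of_nonneg_right h2 h3).trans (le_of_eq ?_)
    rw [neg_mul, one_mul]
    ring
  have i2 : IntegrableOn (fun t => θ⁻¹ * binetKernel (t / θ) * Real.exp (-t)) (Set.Ioi 0) := by
    have := (integrableOn_Ioi_scale hθ (integrableOn_binet hθ)).const_mul θ⁻¹
    refine IntegrableOn.congr_fun this (fun t _ => ?_) measurableSet_Ioi
    have : -θ * (t / θ) = -t := by field_simp
    simp only [this]
    ring
  rw [binetIntegral_scale hθ, binetIntegral, ← integral_add i1 (integrableOn_binet one_pos),
    ← integral_add i2 (integrableOn_binetProduct hθ)]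
  refine setIntegral_congr_fun measurableSet_Ioi fun t ht => ?_
  have ht0 : t ≠ 0 := ne_of_gt ht
  simp only [binetProduct, neg_mul, one_mul]
  rw [binetKernel.eq_1 t]
  field_simp
  ring

/-- The logarithmic growth of `θ ∑_{j ≤ n} ψ₁(θ j)` with its constant term. -/
theorem tendsto_sum_polygamma_one (hθ : 0 < θ) :
    Tendsto (fun n : ℕ => (∑ j ∈ Finset.range n, θ * polygamma 1 (θ * ((j : ℝ) + 1)))
        - (Real.log n + Real.log θ - polygamma 0 θ + 1 + logDetConst (2 * θ))) atTop (𝓝 0) := by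
  have h := ((tendsto_sum_polygamma_one_sub_harmonic hθ).add
    Real.tendsto_harmonic_sub_log).sub_const
      (Real.log θ - polygamma 0 θ + 1 + logDetConst (2 * θ))
  have hid := integral_identity hθ
  rw [binetIntegral_one] at hid
  have h0 : (∫ t in Set.Ioi (0 : ℝ), t / θ * binetKernel (t / θ)
        * ((1 - Real.exp (-t))⁻¹ * Real.exp (-t))) + Real.eulerMascheroniConstant
      - (Real.log θ - polygamma 0 θ + 1 + logDetConst (2 * θ)) = 0 := by
    rw [hid, polygamma_zero_eq hθ, logDetConst_eq hθ]
    ring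
  rw [h0] at h
  refine h.congr fun n => ?_
  ring

end LogDetConst

/-! ### Special values of `K_β` -/

theorem logDetConst_two : logDetConst 2 = 0 := by
  rw [logDetConst]
  have : ∀ t : ℝ, logDetConstIntegrand 2 t = 0 := by
    intro t
    rw [logDetConstIntegrand, show 2 * t / 2 = t by ring]
    ring
  simp [this]

theorem logDetConst_four : logDetConst 4 = 1 - Real.pi ^ 2 / 8 := by
  have h : ∀ t ∈ Set.Ioi (0 : ℝ), logDetConstIntegrand 4 t
      = -2 * (t * (1 - Real.exp (-t))⁻¹ * Real.exp (-(1 / 2 + 1) * t)) := by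
    intro t ht
    have ht' : 0 < t / 2 := half_pos ht
    have h1 := (exp_sub_one_pos ht').ne'
    have e1 : Real.exp t = Real.exp (t / 2) ^ 2 := by
      rw [← Real.exp_nat_mul]; congr 1; push_cast; ring
    have e2 : Real.exp (-2 * t * (1 - 1 / 4)) = Real.exp (-(1 / 2 + 1) * t) := by
      congr 1; ring
    rw [logDetConstIntegrand, show 2 * t / 4 = t / 2 by ring, e1, e2]
    generalize (1 - Real.exp (-t))⁻¹ = w
    field_simp
    ring
  rw [logDetConst, setIntegral_congr_fun measurableSet_Ioi h, integral_const_mul,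
    ← trigammaIntegral, ← polygamma_one_eq (by norm_num), polygamma_one_add_one one_half_pos,
    polygamma_one_one_half]
  ring

lemma integral_id_mul_exp_div_sq :
    IntegrableOn (fun t : ℝ => t * Real.exp t * ((Real.exp t + 1) ^ 2)⁻¹) (Set.Ioi 0) ∧
    ∫ t in Set.Ioi (0 : ℝ), t * Real.exp t * ((Real.exp t + 1) ^ 2)⁻¹ = Real.log 2 := by
  have hder : ∀ t ∈ Set.Ici (0 : ℝ), HasDerivAt
      (fun t : ℝ => -(t * (Real.exp t + 1)⁻¹) - Real.log (1 + Real.exp (-t)))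
      (t * Real.exp t * ((Real.exp t + 1) ^ 2)⁻¹) t := by
    intro t _
    have hp := Real.exp_pos t
    have hn := Real.exp_pos (-t)
    have h1 : HasDerivAt (fun t : ℝ => (Real.exp t + 1)⁻¹)
        (-Real.exp t / (Real.exp t + 1) ^ 2) t :=
      ((Real.hasDerivAt_exp t).add_const 1).inv (by positivity)
    have h2 : HasDerivAt (fun t : ℝ => Real.log (1 + Real.exp (-t)))
        (Real.exp (-t) * -1 / (1 + Real.exp (-t))) t :=
      ((hasDerivAt_neg t).exp.const_add 1).log (by positivity)
    refine (((hasDerivAt_id t).mul h1).neg.sub h2).congr_deriv ?_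
    rw [Real.exp_neg]
    simp only [id]
    field_simp
    ring
  have hpos : ∀ t ∈ Set.Ioi (0 : ℝ), 0 ≤ t * Real.exp t * ((Real.exp t + 1) ^ 2)⁻¹ := by
    intro t ht
    have ht' : 0 < t := ht
    positivity
  have hlim : Tendsto (fun t : ℝ => -(t * (Real.exp t + 1)⁻¹) - Real.log (1 + Real.exp (-t)))
      atTop (𝓝 0) := by
    have h1 : Tendsto (fun t : ℝ => t * (Real.exp t + 1)⁻¹) atTop (𝓝 0) := by
      have h := Real.tendsto_pow_mul_exp_neg_atTop_nhds_zero 1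
      refine squeeze_zero' ?_ ?_ h
      · filter_upwards [eventually_ge_atTop 0] with t ht
        positivity
      · filter_upwards [eventually_ge_atTop 0] with t ht
        rw [pow_one, Real.exp_neg]
        gcongr
        linarith
    have h2 : Tendsto (fun t : ℝ => Real.log (1 + Real.exp (-t))) atTop (𝓝 (Real.log (1 + 0))) :=
      (Real.tendsto_exp_neg_atTop_nhds_zero.const_add 1).log (by norm_num)
    simpa using h1.neg.sub h2
  refine ⟨integrableOn_Ioi_deriv_of_nonneg' hder hpos hlim, ?_⟩
  rw [integral_Ioi_of_hasDerivAt_of_nonneg' hder hpos hlim]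
  norm_num

theorem logDetConst_one : logDetConst 1 = Real.pi ^ 2 / 8 - Real.log 2 := by
  have hs := integral_Ioi_scale (θ := 1 / 2) one_half_pos
    fun s => s * (1 - Real.exp (-s))⁻¹ * Real.exp (-(1 / 2) * s)
  have hi := integrableOn_Ioi_scale (θ := 1 / 2) one_half_pos (integrableOn_trigamma one_half_pos)
  rw [← trigammaIntegral, ← polygamma_one_eq one_half_pos, polygamma_one_one_half] at hs
  have h : ∀ t ∈ Set.Ioi (0 : ℝ), logDetConstIntegrand 1 t
      = 1 / 4 * (t / (1 / 2) * (1 - Real.exp (-(t / (1 / 2))))⁻¹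
          * Real.exp (-(1 / 2) * (t / (1 / 2))))
        - 1 / 2 * (t * Real.exp t * ((Real.exp t + 1) ^ 2)⁻¹) := by
    intro t ht
    have h1 := (exp_sub_one_pos ht).ne'
    have hp := Real.exp_pos t
    have h2 : Real.exp t + 1 ≠ 0 := by positivity
    have e1 : Real.exp (-(t / (1 / 2))) = (Real.exp t ^ 2)⁻¹ := by
      rw [← Real.exp_nat_mul, ← Real.exp_neg]; congr 1; push_cast; ring
    have e2 : Real.exp (2 * t / 1) = Real.exp t ^ 2 := by
      rw [← Real.exp_nat_mul]; congr 1; push_cast; ring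
    have e3 : Real.exp (-2 * t * (1 - 1 / 1)) = 1 := by simp
    have e4 : Real.exp (-(1 / 2) * (t / (1 / 2))) = (Real.exp t)⁻¹ := by
      rw [← Real.exp_neg]; congr 1; ring
    have e5 : (1 - (Real.exp t)⁻¹) = (Real.exp t - 1) / Real.exp t := by field_simp
    have e6 : (1 - (Real.exp t ^ 2)⁻¹) = (Real.exp t - 1) * (Real.exp t + 1) / Real.exp t ^ 2 := by
      field_simp
      ring
    have e7 : Real.exp t ^ 2 - 1 = (Real.exp t - 1) * (Real.exp t + 1) := by ring
    rw [logDetConstIntegrand, e1, e2, e3, e4, Real.exp_neg, e5, e6, e7]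
    field_simp
    ring
  rw [logDetConst, setIntegral_congr_fun measurableSet_Ioi h,
    integral_sub (hi.const_mul _) (integral_id_mul_exp_div_sq.1.const_mul _),
    integral_const_mul, integral_const_mul, integral_id_mul_exp_div_sq.2, ← hs]
  ring

/-! ### Convex solutions of a difference equation -/

lemma convexOn_slope_bounds {c : ℝ} {φ h : ℝ → ℝ} (hφ : ConvexOn ℝ (Set.Ioi c) φ)
    (hr : ∀ x, c < x → φ (x + 1) = φ x + h x) {x δ : ℝ} (hx : c < x) (h0 : 0 < δ) (h1 : δ < 1) :
    δ * h x ≤ φ (x + 1 + δ) - φ (x + 1) ∧ φ (x + 1 + δ) - φ (x + 1) ≤ δ * h (x + 1) := by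
  have s1 := hφ.slope_mono_adjacent (x := x) (y := x + 1) (z := x + 1 + δ) hx
    (by simp only [Set.mem_Ioi]; linarith) (by linarith) (by linarith)
  have s2 := hφ.slope_mono_adjacent (x := x + 1) (y := x + 1 + δ) (z := x + 1 + 1)
    (by simp only [Set.mem_Ioi]; linarith) (by simp only [Set.mem_Ioi]; linarith)
    (by linarith) (by linarith)
  have e1 := hr x hx
  have e2 := hr (x + 1) (by linarith)
  rw [show x + 1 - x = 1 by ring, show x + 1 + δ - (x + 1) = δ by ring, div_one,
    le_div_iff₀ h0] at s1
  rw [show x + 1 + δ - (x + 1) = δ by ring, show x + 1 + 1 - (x + 1 + δ) = 1 - δ by ring,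
    div_le_div_iff₀ h0 (by linarith)] at s2
  constructor <;> nlinarith

/-- Convex solutions of `φ (x + 1) = φ x + h x` are unique up to an additive constant as soon as
the increments of `h` tend to zero. -/
theorem convexOn_difference_unique {c : ℝ} {φ₁ φ₂ h : ℝ → ℝ} (h1 : ConvexOn ℝ (Set.Ioi c) φ₁)
    (h2 : ConvexOn ℝ (Set.Ioi c) φ₂) (r1 : ∀ x, c < x → φ₁ (x + 1) = φ₁ x + h x)
    (r2 : ∀ x, c < x → φ₂ (x + 1) = φ₂ x + h x)
    (hh : Tendsto (fun x => h (x + 1) - h x) atTop (𝓝 0)) {x y : ℝ} (hx : c < x) (hy : c < y) :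
    φ₁ x - φ₂ x = φ₁ y - φ₂ y := by
  wlog hxy : x ≤ y generalizing x y
  · exact (this hy hx (not_le.1 hxy).le).symm
  set D : ℝ → ℝ := fun z => φ₁ z - φ₂ z with hD
  have hper : ∀ z, c < z → ∀ N : ℕ, D (z + N) = D z := by
    intro z hz N
    induction N with
    | zero => simp
    | succ N ih =>
      have hz' : c < z + N := by linarith [(Nat.cast_nonneg N : (0 : ℝ) ≤ N)]
      rw [← ih, Nat.cast_succ, ← add_assoc]
      simp only [hD, r1 _ hz', r2 _ hz']
      ring
  have hloc : ∀ δ, 0 < δ → δ < 1 → D (x + δ) = D x := by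
    intro δ hδ0 hδ1
    have hb : ∀ N : ℕ, |D (x + δ) - D x| ≤ δ * (h (x + N + 1) - h (x + N)) := by
      intro N
      have hz : c < x + N := by linarith [(Nat.cast_nonneg N : (0 : ℝ) ≤ N)]
      obtain ⟨a1, a2⟩ := convexOn_slope_bounds h1 r1 hz hδ0 hδ1
      obtain ⟨b1, b2⟩ := convexOn_slope_bounds h2 r2 hz hδ0 hδ1
      have e1 := hper (x + δ) (by linarith) (N + 1)
      have e2 := hper x hx (N + 1)
      push_cast at e1 e2
      rw [show x + δ + ((N : ℝ) + 1) = x + N + 1 + δ by ring] at e1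
      rw [show x + ((N : ℝ) + 1) = x + N + 1 by ring] at e2
      rw [← e1, ← e2, abs_le]
      constructor <;> simp only [hD] <;> linarith
    have hlim : Tendsto (fun N : ℕ => δ * (h (x + N + 1) - h (x + N))) atTop (𝓝 (δ * 0)) :=
      (hh.comp (tendsto_atTop_add_const_left _ x tendsto_natCast_atTop_atTop)).const_mul δ
    rw [mul_zero] at hlim
    exact sub_eq_zero.1 (abs_nonpos_iff.1 (ge_of_tendsto' hlim hb))
  set k := ⌊y - x⌋₊ with hk
  have hk1 : (k : ℝ) ≤ y - x := Nat.floor_le (by linarith)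
  have hk2 : y - x < k + 1 := Nat.lt_floor_add_one _
  have hy' : D y = D (y - k) := by
    have := hper (y - k) (by linarith) k
    rwa [sub_add_cancel] at this
  change D x = D y
  rw [hy']
  rcases (sub_nonneg.2 hk1).eq_or_lt with h0 | h0
  · congr 1
    linarith
  · have := hloc (y - x - k) h0 (by linarith)
    rw [← this]
    congr 1
    ring

/-! ### The law of the eigenvalues -/

section Law

variable {n : ℕ} {β : ℝ}

lemma orthant_eq_restrict (n : ℕ) :
    orthant n = volume.restrict (Set.univ.pi fun _ : Fin n => Set.Ioi (0 : ℝ)) := by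
  rw [volume_pi, Measure.restrict_pi_pi, orthant]

lemma measurableSet_finiteEnergyConfigs (n : ℕ) : MeasurableSet (finiteEnergyConfigs n) := by
  have h : finiteEnergyConfigs n = (⋂ i, {x : Fin n → ℝ | 0 < x i}) ∩
      ⋂ i, ⋂ j, {x : Fin n → ℝ | x i = x j → i = j} := by
    ext x
    simp [finiteEnergyConfigs, Function.Injective]
  rw [h]
  refine (MeasurableSet.iInter fun i =>
    measurableSet_lt measurable_const (measurable_pi_apply i)).inter
    (MeasurableSet.iInter fun i => MeasurableSet.iInter fun j => ?_)
  by_cases hij : i = j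
  · simp [hij]
  · have : {x : Fin n → ℝ | x i = x j → i = j} = {x : Fin n → ℝ | x i = x j}ᶜ := by
      ext x
      simp [hij]
    rw [this]
    exact (measurableSet_eq_fun (measurable_pi_apply i) (measurable_pi_apply j)).compl

/-- The Laguerre density on the orthant. -/
noncomputable def density (n : ℕ) (β : ℝ) (x : Fin n → ℝ) : ℝ :=
  vand (β / 4) 0 x * weight (β / 2) (β * n / 2) x

lemma exp_coulombEnergy (hβ : 0 < β) (hn : 1 ≤ n) {x : Fin n → ℝ}
    (hx : x ∈ finiteEnergyConfigs n) : Real.exp (-β * coulombEnergy n β 1 x) = density n β x := by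
  have hn0 : (n : ℝ) ≠ 0 := by positivity
  have hv : vand (β / 4) 0 x = Real.exp (β / 2 * ∑ p ∈ (Finset.univ : Finset (Fin n)).offDiag,
      Real.log |x p.1 - x p.2|) := by
    rw [Finset.mul_sum, Real.exp_sum]
    refine Finset.prod_congr rfl fun p hp => ?_
    have hne : x p.1 - x p.2 ≠ 0 :=
      sub_ne_zero.2 fun h => (Finset.mem_offDiag.1 hp).2.2 (hx.2 h)
    rw [add_zero, Real.rpow_def_of_pos (by positivity), ← sq_abs, Real.log_pow]
    congr 1
    push_cast
    ring
  have hw : weight (β / 2) (β * n / 2) x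
      = Real.exp (-β * (n * ∑ k, laguerrePotential n β 1 (x k))) := by
    rw [Finset.mul_sum, Finset.mul_sum, Real.exp_sum]
    refine Finset.prod_congr rfl fun k _ => ?_
    rw [Real.rpow_def_of_pos (hx.1 k), ← Real.exp_add]
    congr 1
    rw [laguerrePotential, laguerreAlpha]
    field_simp
    ring
  rw [density, hv, hw, ← Real.exp_add, coulombEnergy]
  congr 1
  ring

lemma unnormalizedGibbs_eq (hβ : 0 < β) (hn : 1 ≤ n) : unnormalizedGibbs n β 1
    = (orthant n).withDensity fun x => ENNReal.ofReal (density n β x) := by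
  rw [unnormalizedGibbs, orthant_eq_restrict,
    ← withDensity_indicator (measurableSet_finiteEnergyConfigs n),
    ← withDensity_indicator (MeasurableSet.univ_pi fun _ => measurableSet_Ioi)]
  congr 1
  ext1 x
  by_cases hp : ∀ i, 0 < x i
  · rw [Set.indicator_of_mem (s := Set.univ.pi fun _ => Set.Ioi (0 : ℝ)) (by simpa using hp)]
    by_cases hinj : Function.Injective x
    · rw [Set.indicator_of_mem (s := finiteEnergyConfigs n) ⟨hp, hinj⟩,
        exp_coulombEnergy hβ hn ⟨hp, hinj⟩]
    · rw [Set.indicator_of_notMem fun h => hinj h.2]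
      obtain ⟨i, j, hij, hne⟩ : ∃ i j, x i = x j ∧ i ≠ j := by
        simpa [Function.Injective] using hinj
      rw [density, vand_zero_of_eq (by positivity) hne hij, zero_mul, ENNReal.ofReal_zero]
  · rw [Set.indicator_of_notMem fun h => hp h.1,
      Set.indicator_of_notMem (by simpa using hp)]

lemma measurable_density (n : ℕ) (β : ℝ) : Measurable (density n β) :=
  (measurable_vand _ _).mul (measurable_weight _ _)

lemma density_nonneg (n : ℕ) (β : ℝ) : ∀ᵐ x ∂(orthant n), 0 ≤ density n β x := by
  filter_upwards [ae_orthant_pos n] with x hx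
  exact mul_nonneg (vand_nonneg _ le_rfl x) (weight_pos _ _ hx).le

lemma integrable_vand_mul_weight {a r b : ℝ} (ha : 0 < a) (hr : 0 < r) (hb : 0 ≤ b) :
    Integrable (fun x : Fin n → ℝ => vand b 0 x * weight a r x) (orthant n) := by
  simpa using integrable_prod_mul_vand (n := n) ha hr hb ∅

lemma laguerreIntegral_pos {a r b : ℝ} (ha : 0 < a) (hr : 0 < r) (hb : 0 ≤ b) :
    0 < laguerreIntegral n b a r := by
  have hnn : 0 ≤ᵐ[orthant n] fun x => vand b 0 x * weight a r x := by
    filter_upwards [ae_orthant_pos n] with x hx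
    exact mul_nonneg (vand_nonneg _ le_rfl x) (weight_pos _ _ hx).le
  rw [laguerreIntegral, integral_pos_iff_support_of_nonneg_ae hnn
    (integrable_vand_mul_weight ha hr hb), orthant_eq_restrict]
  have hcont : Continuous (vand (n := n) b 0) := by
    refine continuous_finsetProd _ fun p _ => ?_
    exact (by fun_prop : Continuous fun x : Fin n → ℝ => (x p.1 - x p.2) ^ 2 + 0).rpow_const
      fun _ => Or.inr hb
  have hopen : IsOpen ((Set.univ.pi fun _ : Fin n => Set.Ioi (0 : ℝ)) ∩ {x | 0 < vand b 0 x}) :=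
    (isOpen_set_pi Set.finite_univ fun _ _ => isOpen_Ioi).inter
      (isOpen_lt continuous_const hcont)
  have hne : ((Set.univ.pi fun _ : Fin n => Set.Ioi (0 : ℝ)) ∩ {x | 0 < vand b 0 x}).Nonempty := by
    refine ⟨fun i => (i : ℝ) + 1, fun i _ => ?_, ?_⟩
    · simp only [Set.mem_Ioi]
      positivity
    · refine Finset.prod_pos fun p hp => Real.rpow_pos_of_pos ?_ _
      have h : ((p.1 : ℕ) : ℝ) ≠ ((p.2 : ℕ) : ℝ) := by
        rw [Ne, Nat.cast_inj, Fin.val_inj]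
        exact (Finset.mem_offDiag.1 hp).2.2
      have h' : ((p.1 : ℕ) : ℝ) + 1 - (((p.2 : ℕ) : ℝ) + 1) ≠ 0 := by
        rw [add_sub_add_right_eq_sub]
        exact sub_ne_zero.2 h
      positivity
  rw [Measure.restrict_apply']
  · refine (hopen.measure_pos volume hne).trans_le (measure_mono fun x hx => ⟨?_, hx.1⟩)
    have hw := weight_pos a r (x := x) fun i => hx.1 i (Set.mem_univ i)
    exact (mul_pos hx.2 hw).ne'
  · exact MeasurableSet.univ_pi fun _ => measurableSet_Ioi

/-- The normalisation constant of the ensemble as a function of a shift of the exponent. -/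
noncomputable def shiftedPartition (n : ℕ) (β t : ℝ) : ℝ :=
  laguerreIntegral n (β / 4) (β / 2 + t) (β * n / 2)

lemma shiftedPartition_pos (hβ : 0 < β) (hn : 1 ≤ n) {t : ℝ} (ht : -(β / 2) < t) :
    0 < shiftedPartition n β t :=
  laguerreIntegral_pos (by linarith) (by positivity) (by positivity)

lemma partitionFunction_eq (hβ : 0 < β) (hn : 1 ≤ n) :
    partitionFunction n β 1 = ENNReal.ofReal (shiftedPartition n β 0) := by
  rw [partitionFunction, unnormalizedGibbs_eq hβ hn, withDensity_apply _ MeasurableSet.univ,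
    Measure.restrict_univ, shiftedPartition, laguerreIntegral, add_zero,
    ofReal_integral_eq_lintegral_ofReal
      (integrable_vand_mul_weight (by positivity) (by positivity) (by positivity))
      (density_nonneg n β)]
  rfl

lemma isProbabilityMeasure_law (hβ : 0 < β) (hn : 1 ≤ n) :
    IsProbabilityMeasure (wishartEigenvalueLaw n β 1) := by
  have hpos := shiftedPartition_pos hβ hn (t := 0) (by linarith)
  constructor
  rw [wishartEigenvalueLaw, Measure.smul_apply, smul_eq_mul, ← partitionFunction,
    partitionFunction_eq hβ hn]
  exact ENNReal.inv_mul_cancel (by simpa using hpos) ENNReal.ofReal_ne_top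

lemma exp_mul_density {t : ℝ} {x : Fin n → ℝ} (hx : ∀ i, 0 < x i) :
    Real.exp (t * ∑ i, Real.log (x i)) * density n β x
      = vand (β / 4) 0 x * weight (β / 2 + t) (β * n / 2) x := by
  rw [density, weight_add _ _ _ hx]
  ring

lemma integrable_exp_law (hβ : 0 < β) (hn : 1 ≤ n) {t : ℝ} (ht : -(β / 2) < t) :
    Integrable (fun x : Fin n → ℝ => Real.exp (t * ∑ i, Real.log (x i)))
      (wishartEigenvalueLaw n β 1) := by
  have hpos := shiftedPartition_pos hβ hn (t := 0) (by linarith)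
  rw [wishartEigenvalueLaw]
  refine Integrable.smul_measure ?_ ?_
  · rw [unnormalizedGibbs_eq hβ hn, integrable_withDensity_iff
      (measurable_density n β).ennreal_ofReal (Eventually.of_forall fun _ => ENNReal.ofReal_lt_top)]
    refine (integrable_vand_mul_weight (n := n) (a := β / 2 + t) (r := β * n / 2) (b := β / 4)
      (by linarith) (by positivity) (by positivity)).congr ?_
    filter_upwards [ae_orthant_pos n, density_nonneg n β] with x hx hd
    rw [ENNReal.toReal_ofReal hd, exp_mul_density hx]
  · rw [partitionFunction_eq hβ hn]
    simpa using hpos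

lemma mgf_law (hβ : 0 < β) (hn : 1 ≤ n) (t : ℝ) :
    mgf (fun x : Fin n → ℝ => ∑ i, Real.log (x i)) (wishartEigenvalueLaw n β 1) t
      = shiftedPartition n β t / shiftedPartition n β 0 := by
  have hpos := shiftedPartition_pos hβ hn (t := 0) (by linarith)
  rw [mgf, wishartEigenvalueLaw, integral_smul_measure, unnormalizedGibbs_eq hβ hn,
    integral_withDensity_eq_integral_toReal_smul (measurable_density n β).ennreal_ofReal
      (Eventually.of_forall fun _ => ENNReal.ofReal_lt_top), partitionFunction_eq hβ hn,
    ENNReal.toReal_inv, ENNReal.toReal_ofReal hpos.le, smul_eq_mul, div_eq_inv_mul]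
  congr 1
  refine integral_congr_ae ?_
  filter_upwards [ae_orthant_pos n, density_nonneg n β] with x hx hd
  rw [ENNReal.toReal_ofReal hd, smul_eq_mul, mul_comm, exp_mul_density hx]

/-- The cumulant generating function of the log-determinant. -/
noncomputable def logDetCgf (n : ℕ) (β : ℝ) : ℝ → ℝ :=
  cgf (fun x : Fin n → ℝ => ∑ i, Real.log (x i)) (wishartEigenvalueLaw n β 1)

lemma mem_interior_integrableExpSet (hβ : 0 < β) (hn : 1 ≤ n) {t : ℝ} (ht : -(β / 2) < t) :
    t ∈ interior (integrableExpSet (fun x : Fin n → ℝ => ∑ i, Real.log (x i))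
      (wishartEigenvalueLaw n β 1)) :=
  mem_interior.2 ⟨Set.Ioi (-(β / 2)), fun _ hs => integrable_exp_law hβ hn hs, isOpen_Ioi, ht⟩

lemma convexOn_logDetCgf (hβ : 0 < β) (hn : 1 ≤ n) :
    ConvexOn ℝ (Set.Ioi (-(β / 2))) (logDetCgf n β) := by
  have hmem := fun t (ht : t ∈ Set.Ioi (-(β / 2))) => mem_interior_integrableExpSet hβ hn ht
  refine convexOn_of_deriv2_nonneg' (convex_Ioi _)
    (fun t ht => (analyticAt_cgf (hmem t ht)).differentiableAt.differentiableWithinAt)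
    (fun t ht => (analyticAt_cgf (hmem t ht)).deriv.differentiableAt.differentiableWithinAt)
    fun t ht => ?_
  rw [← iteratedDeriv_eq_iterate, logDetCgf, ← variance_tilted_mul (hmem t ht)]
  exact variance_nonneg _ _

lemma logDetCgf_add_one (hβ : 0 < β) (hn : 1 ≤ n) {t : ℝ} (ht : -(β / 2) < t) :
    logDetCgf n β (t + 1) = logDetCgf n β t
      + ∑ j ∈ Finset.range n, (Real.log (β / 2 * ((j : ℝ) + 1) + t) - Real.log (β * n / 2)) := by
  have h0 := shiftedPartition_pos hβ hn (t := 0) (by linarith)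
  have ht0 := shiftedPartition_pos hβ hn ht
  have hr : 0 < β * n / 2 := by positivity
  have hj : ∀ j : ℕ, 0 < β / 2 * ((j : ℝ) + 1) + t := fun j => by
    have : 0 ≤ β / 2 * j := by positivity
    linarith
  have hrec : shiftedPartition n β (t + 1)
      = (∏ j ∈ Finset.range n, ((β / 2 * ((j : ℝ) + 1) + t) / (β * n / 2)))
        * shiftedPartition n β t := by
    rw [shiftedPartition, ← add_assoc, laguerreIntegral_add_one (by linarith) hr (by positivity)]
    congr 1
    refine Finset.prod_congr rfl fun j _ => ?_
    congr 1
    ring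
  rw [logDetCgf, cgf, cgf, mgf_law hβ hn, mgf_law hβ hn, hrec, mul_div_assoc,
    Real.log_mul (Finset.prod_ne_zero_iff.2 fun j _ => (div_pos (hj j) hr).ne')
      (div_pos ht0 h0).ne', Real.log_prod fun j _ => (div_pos (hj j) hr).ne', add_comm]
  congr 1
  exact Finset.sum_congr rfl fun j _ => Real.log_div (hj j).ne' hr.ne'

/-- The sum of log-Gamma functions solving the same difference equation. -/
noncomputable def logGammaSum (n : ℕ) (β t : ℝ) : ℝ :=
  ∑ j ∈ Finset.range n,
    (Real.log (Real.Gamma (β / 2 * ((j : ℝ) + 1) + t)) - t * Real.log (β * n / 2))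

lemma shift_pos (hβ : 0 < β) {t : ℝ} (ht : -(β / 2) < t) (j : ℕ) :
    0 < β / 2 * ((j : ℝ) + 1) + t := by
  have : 0 ≤ β / 2 * j := by positivity
  linarith

lemma convexOn_logGammaSum (hβ : 0 < β) :
    ConvexOn ℝ (Set.Ioi (-(β / 2))) (logGammaSum n β) := by
  have h1 : ∀ j : ℕ, ConvexOn ℝ (Set.Ioi (-(β / 2))) fun t =>
      Real.log (Real.Gamma (β / 2 * ((j : ℝ) + 1) + t)) - t * Real.log (β * n / 2) := by
    intro j
    refine ⟨convex_Ioi _, fun s hs t ht u v hu hv huv => ?_⟩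
    have h := Real.convexOn_log_Gamma.2 (Set.mem_Ioi.2 (shift_pos hβ hs j))
      (Set.mem_Ioi.2 (shift_pos hβ ht j)) hu hv huv
    have e : u • (β / 2 * ((j : ℝ) + 1) + s) + v • (β / 2 * ((j : ℝ) + 1) + t)
        = β / 2 * ((j : ℝ) + 1) + (u • s + v • t) := by
      simp only [smul_eq_mul]
      linear_combination (β / 2 * ((j : ℝ) + 1)) * huv
    rw [e] at h
    simp only [smul_eq_mul, Function.comp_apply] at h ⊢
    linarith
  refine ⟨convex_Ioi _, fun s hs t ht u v hu hv huv => ?_⟩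
  simp only [logGammaSum, smul_eq_mul, Finset.mul_sum, ← Finset.sum_add_distrib]
  exact Finset.sum_le_sum fun j _ => (h1 j).2 hs ht hu hv huv

lemma logGammaSum_add_one (hβ : 0 < β) {t : ℝ} (ht : -(β / 2) < t) :
    logGammaSum n β (t + 1) = logGammaSum n β t
      + ∑ j ∈ Finset.range n, (Real.log (β / 2 * ((j : ℝ) + 1) + t) - Real.log (β * n / 2)) := by
  rw [logGammaSum, logGammaSum, ← Finset.sum_add_distrib]
  refine Finset.sum_congr rfl fun j _ => ?_
  rw [← add_assoc, log_Gamma_add_one (shift_pos hβ ht j)]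
  ring

lemma tendsto_increment (n : ℕ) (β : ℝ) : Tendsto (fun t : ℝ =>
    (∑ j ∈ Finset.range n, (Real.log (β / 2 * ((j : ℝ) + 1) + (t + 1)) - Real.log (β * n / 2)))
    - ∑ j ∈ Finset.range n, (Real.log (β / 2 * ((j : ℝ) + 1) + t) - Real.log (β * n / 2)))
    atTop (𝓝 0) := by
  have h : ∀ j : ℕ, Tendsto (fun t : ℝ => Real.log (β / 2 * ((j : ℝ) + 1) + (t + 1))
      - Real.log (β / 2 * ((j : ℝ) + 1) + t)) atTop (𝓝 0) := by
    intro j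
    have h1 := tendsto_atTop_add_const_left atTop (β / 2 * ((j : ℝ) + 1)) tendsto_id (α := ℝ)
    have h2 : Tendsto (fun u : ℝ => Real.log (u + 1) - Real.log u) atTop (𝓝 0) :=
      Real.tendsto_log_comp_add_sub_log 1
    refine (h2.comp h1).congr fun t => ?_
    simp only [Function.comp_apply, id, add_assoc]
  have hs := tendsto_finsetSum (Finset.range n) fun j _ => h j
  rw [Finset.sum_const_zero] at hs
  refine hs.congr fun t => ?_
  rw [← Finset.sum_sub_distrib]
  exact Finset.sum_congr rfl fun j _ => by ring

theorem logDetCgf_eq (hβ : 0 < β) (hn : 1 ≤ n) {t : ℝ} (ht : -(β / 2) < t) :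
    logDetCgf n β t = logGammaSum n β t + (logDetCgf n β 0 - logGammaSum n β 0) := by
  have := convexOn_difference_unique (convexOn_logDetCgf hβ hn) (convexOn_logGammaSum (n := n) hβ)
    (fun t ht => logDetCgf_add_one hβ hn ht) (fun t ht => logGammaSum_add_one hβ ht)
    (tendsto_increment n β) ht (y := 0) (by linarith)
  linarith

lemma iteratedDeriv_two_logDetCgf (hβ : 0 < β) (hn : 1 ≤ n) :
    iteratedDeriv 2 (logDetCgf n β) 0
      = ∑ j ∈ Finset.range n, polygamma 1 (β * ((j : ℝ) + 1) / 2) := by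
  have h0 : -(β / 2) < (0 : ℝ) := by linarith
  have hd1 : ∀ t, -(β / 2) < t → HasDerivAt (logDetCgf n β)
      (∑ j ∈ Finset.range n, (polygamma 0 (β / 2 * ((j : ℝ) + 1) + t) - 1 * Real.log (β * n / 2)))
      t := by
    intro t ht
    have h : HasDerivAt (fun t => logGammaSum n β t + (logDetCgf n β 0 - logGammaSum n β 0))
        (∑ j ∈ Finset.range n, (polygamma 0 (β / 2 * ((j : ℝ) + 1) + t)
          - 1 * Real.log (β * n / 2))) t := by
      refine HasDerivAt.add_const _ (HasDerivAt.fun_sum fun j _ => ?_)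
      exact ((hasDerivAt_log_Gamma (shift_pos hβ ht j)).comp_const_add _ t).sub
        ((hasDerivAt_id t).mul_const _)
    refine h.congr_of_eventuallyEq ?_
    filter_upwards [eventually_gt_nhds ht] with s hs using logDetCgf_eq hβ hn hs
  have hd2 : HasDerivAt (deriv (logDetCgf n β))
      (∑ j ∈ Finset.range n, polygamma 1 (β / 2 * ((j : ℝ) + 1) + 0)) 0 := by
    have h : HasDerivAt (fun t => ∑ j ∈ Finset.range n,
        (polygamma 0 (β / 2 * ((j : ℝ) + 1) + t) - 1 * Real.log (β * n / 2)))
        (∑ j ∈ Finset.range n, polygamma 1 (β / 2 * ((j : ℝ) + 1) + 0)) 0 := by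
      refine HasDerivAt.fun_sum fun j _ => ?_
      exact ((hasDerivAt_polygamma_zero' (shift_pos hβ h0 j)).comp_const_add _ 0).sub_const _
    refine h.congr_of_eventuallyEq ?_
    filter_upwards [eventually_gt_nhds h0] with s hs using (hd1 s hs).deriv
  rw [iteratedDeriv_succ, iteratedDeriv_one, hd2.deriv]
  refine Finset.sum_congr rfl fun j _ => ?_
  congr 1
  ring

theorem variance_scaledLogDet (hβ : 0 < β) (hn : 1 ≤ n) :
    variance (scaledLogDet n) (wishartEigenvalueLaw n β 1)
      = 1 / (n : ℝ) ^ 2 * ∑ j ∈ Finset.range n, polygamma 1 (β * ((j : ℝ) + 1) / 2) := by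
  have := isProbabilityMeasure_law hβ hn
  have h := variance_tilted_mul (mem_interior_integrableExpSet hβ hn (t := 0) (by linarith))
  simp only [zero_mul, tilted_const] at h
  have he : scaledLogDet n = fun x => 1 / (n : ℝ) * ∑ i, Real.log (x i) := rfl
  rw [he, variance_const_mul, h, ← iteratedDeriv_two_logDetCgf hβ hn, div_pow, one_pow]
  rfl

theorem memLp_scaledLogDet (hβ : 0 < β) (hn : 1 ≤ n) :
    MemLp (scaledLogDet n) 2 (wishartEigenvalueLaw n β 1) :=
  (memLp_of_mem_interior_integrableExpSet
    (mem_interior_integrableExpSet hβ hn (t := 0) (by linarith)) 2).const_mul _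

theorem tendsto_variance (hβ : 0 < β) :
    Tendsto (fun n : ℕ =>
        variance (scaledLogDet n) (wishartEigenvalueLaw n β 1) / (2 / (β * (n : ℝ) ^ 2))
          - (Real.log n + Real.log (β / 2) - polygamma 0 (β / 2) + 1 + logDetConst β))
      atTop (𝓝 0) := by
  have h := tendsto_sum_polygamma_one (θ := β / 2) (by positivity)
  rw [mul_div_cancel₀ β (two_ne_zero)] at h
  refine h.congr' ?_
  filter_upwards [eventually_ge_atTop 1] with n hn
  have hn0 : (n : ℝ) ≠ 0 := by positivity
  rw [variance_scaledLogDet hβ hn, ← Finset.mul_sum]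
  congr 1
  have e : ∀ j : ℕ, β / 2 * ((j : ℝ) + 1) = β * ((j : ℝ) + 1) / 2 := fun j => by ring
  simp only [e]
  field_simp

end Law

end LaguerreEnsemble

theorem mainTheorem3 :
    (∀ β : ℝ, 0 < β →
      (∀ n : ℕ, 1 ≤ n →
        IsProbabilityMeasure (wishartEigenvalueLaw n β 1) ∧
        MemLp (scaledLogDet n) 2 (wishartEigenvalueLaw n β 1) ∧
        variance (scaledLogDet n) (wishartEigenvalueLaw n β 1)
          = 1 / (n : ℝ) ^ 2 *
              ∑ j ∈ Finset.range n, polygamma 1 (β * ((j : ℝ) + 1) / 2)) ∧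
      IntegrableOn (logDetConstIntegrand β) (Set.Ioi 0) ∧
      Tendsto (fun n : ℕ =>
          variance (scaledLogDet n) (wishartEigenvalueLaw n β 1) / (2 / (β * (n : ℝ) ^ 2))
            - (Real.log n + Real.log (β / 2) - polygamma 0 (β / 2) + 1 + logDetConst β))
        atTop (𝓝 0)) ∧
    logDetConst 1 = Real.pi ^ 2 / 8 - Real.log 2 ∧
    logDetConst 2 = 0 ∧
    logDetConst 4 = 1 - Real.pi ^ 2 / 8 := by
  refine ⟨fun β hβ => ⟨fun n hn => ⟨LaguerreEnsemble.isProbabilityMeasure_law hβ hn,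
    LaguerreEnsemble.memLp_scaledLogDet hβ hn, LaguerreEnsemble.variance_scaledLogDet hβ hn⟩, ?_,
    LaguerreEnsemble.tendsto_variance hβ⟩, LaguerreEnsemble.logDetConst_one,
    LaguerreEnsemble.logDetConst_two, LaguerreEnsemble.logDetConst_four⟩
  have h := LaguerreEnsemble.integrableOn_logDetConstIntegrand (θ := β / 2) (by positivity)
  rwa [mul_div_cancel₀ β (two_ne_zero)] at h
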